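/- Let $\zeta$ be the Riemann zeta function and let $a,b$ be real numbers with $\tfrac12\le b<1$, $a>0$ and $a(1-b)<\tfrac{\pi}{2}$. Then the integral and the series in $$\frac{a}{\pi}\int_0^\infty\frac{\ln|\zeta(b+it)|}{\cosh(at)}\,dt=\frac12\ln\frac{1-\sin(a(1-b))}{1+\sin(a(1-b))}+\sum_{n=0}^\infty(-1)^n\ln\zeta\!\left(b+\frac{\pi}{2a}+\frac{\pi n}{a}\right)\qquad(*)$$ converge absolutely, and the equality $(*)$ holds for the given pair $(a,b)$ if and only if $\zeta$ has no zeros $s$ with $\operatorname{Re}s>b$. In particular, if $b=\tfrac12$ (so $0<a<\pi$), then the equality $(*)$ holds if and only if the Riemann hypothesis is true. -/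

import Mathlib

open MeasureTheory

/-- The integrand `ln |ζ(b + i t)| / cosh (a t)` as a function of the real variable `t`. -/
noncomputable def logZetaCoshIntegrand (a b t : ℝ) : ℝ :=
  Real.log ‖riemannZeta ((b : ℂ) + (t : ℂ) * Complex.I)‖ / Real.cosh (a * t)

/-- The term `(-1)^n ln ζ(b + π/(2a) + π n/a)` of the alternating sum (with the principal logarithm;
the argument of `ζ` is a real number). -/
noncomputable def logZetaTerm (a b : ℝ) (n : ℕ) : ℂ :=
  (-1 : ℂ) ^ n *
    Complex.log (riemannZeta ((b + Real.pi / (2 * a) + Real.pi * (n : ℝ) / a : ℝ) : ℂ))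

/-- The identity
`(a/π) ∫_0^∞ ln|ζ(b+it)| / cosh(at) dt
  = (1/2) ln [(1 - sin(a(1-b))) / (1 + sin(a(1-b)))] + ∑_{n ≥ 0} (-1)^n ln ζ(b + π/(2a) + πn/a)`,
read as an equation between complex numbers. -/
def LogZetaCoshIdentity (a b : ℝ) : Prop :=
  ((a / Real.pi * ∫ t in Set.Ioi (0 : ℝ), logZetaCoshIntegrand a b t : ℝ) : ℂ) =
    ((1 / 2 * Real.log ((1 - Real.sin (a * (1 - b))) / (1 + Real.sin (a * (1 - b)))) : ℝ) : ℂ) +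
      ∑' n : ℕ, logZetaTerm a b n

/-!
Let `κ(t) = a / (2π cosh (a t))`. The left-hand side of the identity is
`M(b) = ∫ κ(t) log |ζ(b + it)| dt` over the whole line, as `|ζ|` is symmetric about the real axis.
The point is that `κ` is the density, on each of the two edges, of the harmonic measure of a
vertical strip of width `π / a` seen from the middle of the strip: under the conformal map
`stripMap` from the unit disc, with `0` going to the middle, circle averages become integrals
against `κ` (`circleAverage_eq_integral_sechKernel`). Jensen's formula in the disc therefore
becomes, for the strip with edges `Re s = b` and `Re s = b + π / a` and centre `c = b + π / (2a)`,

  `M_f(b) + M_f(b + π / a) = log |f(c)| + (a positive contribution of each zero in the strip)`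

for entire functions `f` of moderate growth. Apply this to `f(s) = (s - 1) ζ(s)` and to the factor
`s - 1`, and subtract. The hypothesis `a (1 - b) < π / 2` says that `c > 1`, so that the zero of
`s - 1` lies in the left half of the strip. Its contribution is minus the logarithm of the
pseudo-hyperbolic distance from `1` to `c`, and after the subtraction this becomes the first term of
the identity (`log_norm_stripInv_ofReal`). In the strips further to the right `ζ` has neither zeros
nor a pole, so `M(β) + M(β + π / a) = log |ζ(β + π / (2a))|` for `β > 1`, and as `M(β) → 0` for
`β → ∞`, telescoping turns `M(b + π / a)` into the alternating series
(`logLineMean_riemannZeta_eq_tsum`). Altogether the two sides of the identity differ by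
`zetaStripDefect`, the contribution of the zeros of `ζ` with `Re s > b`, and the identity holds if
and only if there are none.

The analytic work is in passing from circles of radius `r < 1` to the boundary. In general only an
upper bound for `log |f|` is available there, and Fatou's lemma gives the integrability on the edges
and an inequality (`integrable_and_le_logLineMean_add`), which becomes strict if there is a zero
(`log_norm_lt_logLineMean_add`). Conversely, if there are no zeros with `Re s > b`, the
Borel-Carathéodory theorem gives a linear bound for `|log |f||` in each smaller half-plane
(`exists_abs_log_norm_riemannZeta₁_le`), so that dominated convergence gives the equality for the
strips shifted to the right by `δ > 0`. To let `δ → 0` in spite of possible zeros on the line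
`Re s = b` itself, the logarithmic singularities are dominated on compact pieces
(`exists_intervalIntegrable_majorant`), and the tails are controlled by the uniformly bounded means
for the weight of parameter `a / 2`, which decays more slowly (`logLineMean_add_le_of_ne_zero`).

The upper bound for `log |(s - 1) ζ(s)|` comes from the representation of `ζ` in `Re s > 0` by the
Mellin transform of the fractional part (`riemannZeta₁_eq_of_re_pos`).
-/

open Real Set Filter Topology

/-! ### The hyperbolic secant kernel -/

/-- The Poisson kernel of a vertical strip of width `π / a`, seen from the centre of the strip: half
of the hyperbolic secant density. Each of the two boundary lines carries this density. -/
noncomputable def sechKernel (a t : ℝ) : ℝ := a / (2 * π * cosh (a * t))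

/-- The argument in `(0, π)` of the point of the unit circle which corresponds to the height `t` on
the right-hand boundary line of the strip. -/
noncomputable def stripAngle (a t : ℝ) : ℝ := 2 * arctan (exp (a * t))

lemma sechKernel_pos {a : ℝ} (ha : 0 < a) (t : ℝ) : 0 < sechKernel a t := by
  have := cosh_pos (a * t)
  unfold sechKernel; positivity

lemma continuous_sechKernel (a : ℝ) : Continuous (sechKernel a) := by
  unfold sechKernel
  have h : ∀ t : ℝ, 2 * π * cosh (a * t) ≠ 0 := fun t => by
    have := cosh_pos (a * t)
    positivity
  exact continuous_const.div (by fun_prop) h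

lemma hasDerivAt_stripAngle (a t : ℝ) :
    HasDerivAt (stripAngle a) (2 * π * sechKernel a t) t := by
  have h1 : HasDerivAt (fun t : ℝ => exp (a * t)) (exp (a * t) * a) t := by
    simpa using ((hasDerivAt_id t).const_mul a).exp
  have h2 := (h1.arctan).const_mul 2
  refine h2.congr_deriv ?_
  have hc := cosh_pos (a * t)
  have he := exp_pos (a * t)
  have : cosh (a * t) = (exp (a * t) ^ 2 + 1) / (2 * exp (a * t)) := by
    rw [cosh_eq, exp_neg]; field_simp
  unfold sechKernel
  rw [this]
  field_simp
  ring

lemma stripAngle_mem (a t : ℝ) : stripAngle a t ∈ Ioo 0 π := by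
  unfold stripAngle
  have h1 := arctan_pos.2 (exp_pos (a * t))
  have h2 := arctan_lt_pi_div_two (exp (a * t))
  constructor <;> linarith

lemma stripAngle_injective {a : ℝ} (ha : 0 < a) : Function.Injective (stripAngle a) := by
  intro x y h
  have h1 : arctan (exp (a * x)) = arctan (exp (a * y)) := by unfold stripAngle at h; linarith
  have h2 := exp_injective (arctan_injective h1)
  exact mul_left_cancel₀ ha.ne' h2

lemma image_stripAngle {a : ℝ} (ha : 0 < a) : stripAngle a '' univ = Ioo 0 π := by
  ext θ
  constructor
  · rintro ⟨t, -, rfl⟩; exact stripAngle_mem a t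
  · rintro ⟨h0, h1⟩
    have ht : 0 < tan (θ / 2) := tan_pos_of_pos_of_lt_pi_div_two (by linarith) (by linarith)
    refine ⟨log (tan (θ / 2)) / a, trivial, ?_⟩
    unfold stripAngle
    rw [mul_div_cancel₀ _ ha.ne', exp_log ht, arctan_tan (by linarith) (by linarith)]
    ring

lemma integral_Ioo_eq_integral_sechKernel {a : ℝ} (ha : 0 < a) (G : ℝ → ℝ) :
    ∫ θ in Ioo 0 π, G θ = 2 * π * ∫ t, sechKernel a t * G (stripAngle a t) := by
  have h := integral_image_eq_integral_abs_deriv_smul (f := stripAngle a) MeasurableSet.univ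
    (fun x _ => (hasDerivAt_stripAngle a x).hasDerivWithinAt)
    (stripAngle_injective ha).injOn G
  rw [image_stripAngle ha, setIntegral_univ] at h
  rw [h, ← integral_const_mul]
  congr 1; ext t
  have := sechKernel_pos ha t
  rw [abs_of_pos (by positivity), smul_eq_mul]; ring

lemma integrable_sechKernel_mul_iff {a : ℝ} (ha : 0 < a) (G : ℝ → ℝ) :
    Integrable (fun t => sechKernel a t * G (stripAngle a t)) ↔ IntegrableOn G (Ioo 0 π) := by
  have h := integrableOn_image_iff_integrableOn_abs_deriv_smul (f := stripAngle a)
    MeasurableSet.univ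
    (fun x _ => (hasDerivAt_stripAngle a x).hasDerivWithinAt)
    (stripAngle_injective ha).injOn G
  rw [image_stripAngle ha, integrableOn_univ] at h
  rw [h]
  have : (fun x => |2 * π * sechKernel a x| • G (stripAngle a x)) =
      fun x => (2 * π) * (sechKernel a x * G (stripAngle a x)) := by
    ext t
    have := sechKernel_pos ha t
    rw [abs_of_pos (by positivity), smul_eq_mul]; ring
  rw [this, integrable_const_mul_iff (by simp [pi_ne_zero])]

lemma integrable_sechKernel {a : ℝ} (ha : 0 < a) : Integrable (sechKernel a) := by
  have := (integrable_sechKernel_mul_iff ha (fun _ => 1)).2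
    (integrableOn_const (by simp))
  simpa using this

lemma one_add_abs_le_mul_cosh {x : ℝ} : 1 + |x| ≤ 2 * cosh x := by
  rw [← cosh_abs, cosh_eq]
  have h1 := add_one_le_exp |x|
  have h2 := exp_pos (-|x|)
  linarith

lemma cosh_sq_half_le (x : ℝ) : cosh (x / 2) ^ 2 ≤ cosh x := by
  have h : cosh x = cosh (x / 2) ^ 2 + sinh (x / 2) ^ 2 := by
    rw [← cosh_two_mul]; ring_nf
  nlinarith [sq_nonneg (sinh (x / 2))]

/-- Comparison of the kernels of parameters `a` and `a / 2`; the quotient decays. -/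
lemma sechKernel_mul_cosh_le {a : ℝ} (ha : 0 < a) (t : ℝ) :
    sechKernel a t * cosh (a / 2 * t) ≤ 2 * sechKernel (a / 2) t := by
  have h1 := cosh_sq_half_le (a * t)
  have h2 := cosh_pos (a / 2 * t)
  have h3 := cosh_pos (a * t)
  rw [show a * t / 2 = a / 2 * t by ring] at h1
  unfold sechKernel
  rw [div_mul_eq_mul_div, mul_div_assoc', div_le_div_iff₀ (by positivity) (by positivity)]
  nlinarith [mul_le_mul_of_nonneg_left h1 (by positivity : (0:ℝ) ≤ a * 2 * π)]

lemma integrable_sechKernel_mul_one_add_abs {a : ℝ} (ha : 0 < a) :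
    Integrable (fun t => sechKernel a t * (1 + |t|)) := by
  have h := (integrable_sechKernel (half_pos ha)).const_mul (4 * (1 + 2 / a))
  refine h.mono' ((continuous_sechKernel a).mul (by fun_prop)).aestronglyMeasurable ?_
  refine Eventually.of_forall fun t => ?_
  have h0 := sechKernel_pos ha t
  rw [norm_of_nonneg (by positivity)]
  have h1 : 1 + |t| ≤ (1 + 2 / a) * (2 * cosh (a / 2 * t)) := by
    have h2 := one_add_abs_le_mul_cosh (x := a / 2 * t)
    rw [abs_mul, abs_of_pos (half_pos ha)] at h2
    have h3 : 1 + |t| ≤ (1 + 2 / a) * (1 + a / 2 * |t|) := by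
      have : (1 + 2 / a) * (1 + a / 2 * |t|) = 1 + |t| + (2 / a + a / 2 * |t|) := by
        field_simp; ring
      rw [this]
      have : 0 ≤ 2 / a + a / 2 * |t| := by positivity
      linarith
    refine h3.trans ?_
    gcongr
  calc sechKernel a t * (1 + |t|)
      ≤ sechKernel a t * ((1 + 2 / a) * (2 * cosh (a / 2 * t))) := by gcongr
    _ = (1 + 2 / a) * 2 * (sechKernel a t * cosh (a / 2 * t)) := by ring
    _ ≤ (1 + 2 / a) * 2 * (2 * sechKernel (a / 2) t) := by
        exact mul_le_mul_of_nonneg_left (sechKernel_mul_cosh_le ha t) (by positivity)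
    _ = _ := by ring

lemma periodic_comp_circleMap (F : ℂ → ℝ) (r : ℝ) :
    Function.Periodic (fun θ => F (circleMap 0 r θ)) (2 * π) := fun θ => by
  simp [periodic_circleMap 0 r θ]

lemma intervalIntegrable_comp_circleMap {F : ℂ → ℝ} {r : ℝ} (hF : CircleIntegrable F 0 r)
    (x y : ℝ) : IntervalIntegrable (fun θ => F (circleMap 0 r θ)) volume x y :=
  (periodic_comp_circleMap F r).intervalIntegrable (t := 0) two_pi_pos.ne'
    (by simpa [CircleIntegrable] using hF) x y

lemma integrable_sechKernel_mul_of_circleIntegrable {a : ℝ} {F : ℂ → ℝ} (ha : 0 < a) {r : ℝ}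
    (hF : CircleIntegrable F 0 r) :
    Integrable (fun t => sechKernel a t * F (circleMap 0 r (stripAngle a t))) ∧
    Integrable (fun t => sechKernel a t * F (circleMap 0 r (-stripAngle a t))) := by
  have hI := intervalIntegrable_comp_circleMap hF
  constructor
  · refine (integrable_sechKernel_mul_iff ha (fun θ => F (circleMap 0 r θ))).2 ?_
    exact ((intervalIntegrable_iff_integrableOn_Ioo_of_le pi_pos.le).1 (hI 0 π))
  · refine (integrable_sechKernel_mul_iff ha (fun θ => F (circleMap 0 r (-θ)))).2 ?_
    refine ((intervalIntegrable_iff_integrableOn_Ioo_of_le pi_pos.le).1 ?_)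
    have h := hI 0 (-π)
    rw [IntervalIntegrable.iff_comp_neg] at h
    simpa using h

/-- Circle averages about the origin as averages over the two boundary lines of the strip. -/
lemma circleAverage_eq_integral_sechKernel {a : ℝ} {F : ℂ → ℝ} (ha : 0 < a) {r : ℝ}
    (hF : CircleIntegrable F 0 r) :
    circleAverage F 0 r = ∫ t, sechKernel a t *
      (F (circleMap 0 r (stripAngle a t)) + F (circleMap 0 r (-stripAngle a t))) := by
  have hper : Function.Periodic (fun θ => F (circleMap 0 r θ)) (2 * π) :=
    periodic_comp_circleMap F r
  have hI := intervalIntegrable_comp_circleMap hF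
  obtain ⟨h1, h2⟩ := integrable_sechKernel_mul_of_circleIntegrable ha hF
  simp_rw [mul_add]
  rw [integral_add h1 h2]
  have e1 := integral_Ioo_eq_integral_sechKernel ha (fun θ => F (circleMap 0 r θ))
  have e2 := integral_Ioo_eq_integral_sechKernel ha (fun θ => F (circleMap 0 r (-θ)))
  have e3 : ∫ θ in 0..2 * π, F (circleMap 0 r θ) = (∫ θ in Ioo 0 π, F (circleMap 0 r θ)) +
      ∫ θ in Ioo 0 π, F (circleMap 0 r (-θ)) := by
    have h3 := hper.intervalIntegral_add_eq 0 (-π)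
    rw [zero_add, show -π + 2 * π = π by ring] at h3
    rw [h3, ← intervalIntegral.integral_add_adjacent_intervals (hI (-π) 0) (hI 0 π),
      ← integral_Ioc_eq_integral_Ioo, ← integral_Ioc_eq_integral_Ioo,
      ← intervalIntegral.integral_of_le pi_pos.le, ← intervalIntegral.integral_of_le pi_pos.le,
      intervalIntegral.integral_comp_neg (fun θ => F (circleMap 0 r θ)), neg_zero, add_comm]
  rw [circleAverage_def, e3, e1, e2, smul_eq_mul, ← mul_add, ← mul_assoc,
    inv_mul_cancel₀ two_pi_pos.ne', one_mul]

/-! ### The conformal map between the disc and the strip -/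

/-- The conformal map of the unit disc onto the strip of width `π / a` centred at `Re s = c`. It
sends `0` to `c`, and the points `-1`, `1` to the two ends of the strip. -/
noncomputable def stripMap (a c : ℝ) (w : ℂ) : ℂ :=
  c - Complex.I / a * Complex.log ((1 + w) / (1 - w))

/-- The inverse of `stripMap`. -/
noncomputable def stripInv (a c : ℝ) (s : ℂ) : ℂ :=
  (Complex.exp (Complex.I * a * (s - c)) - 1) / (Complex.exp (Complex.I * a * (s - c)) + 1)

lemma one_sub_ne_zero_of_norm_lt {w : ℂ} (hw : ‖w‖ < 1) : 1 - w ≠ 0 := by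
  intro h
  rw [sub_eq_zero] at h
  rw [← h] at hw; simp at hw

lemma re_cayley_pos {w : ℂ} (hw : ‖w‖ < 1) : 0 < ((1 + w) / (1 - w)).re := by
  have h1 : 0 < Complex.normSq (1 - w) := Complex.normSq_pos.2 (one_sub_ne_zero_of_norm_lt hw)
  have h2 : w.re ^ 2 + w.im ^ 2 < 1 := by
    have := Complex.sq_norm w
    rw [Complex.normSq_apply] at this
    nlinarith [norm_nonneg w]
  rw [Complex.div_re, ← add_div]
  apply div_pos _ h1
  simp only [Complex.add_re, Complex.sub_re, Complex.one_re, Complex.add_im, Complex.sub_im,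
    Complex.one_im]
  nlinarith

lemma differentiableAt_stripMap (a c : ℝ) {w : ℂ} (hw : ‖w‖ < 1) :
    DifferentiableAt ℂ (stripMap a c) w := by
  unfold stripMap
  have h : (1 + w) / (1 - w) ∈ Complex.slitPlane := Or.inl (re_cayley_pos hw)
  have h0 := one_sub_ne_zero_of_norm_lt hw
  have : DifferentiableAt ℂ (fun w : ℂ => (1 + w) / (1 - w)) w :=
    (by fun_prop : DifferentiableAt ℂ (fun w : ℂ => 1 + w) w).div (by fun_prop) h0
  exact (differentiableAt_const _).sub ((this.clog h).const_mul _)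

lemma stripMap_zero (a c : ℝ) : stripMap a c 0 = c := by simp [stripMap]

lemma stripMap_re (a c : ℝ) (w : ℂ) :
    (stripMap a c w).re = c + ((1 + w) / (1 - w)).arg / a := by
  unfold stripMap
  rw [show Complex.I / (a : ℂ) = ((1 / a : ℝ) : ℂ) * Complex.I by push_cast; ring]
  simp only [Complex.sub_re, Complex.ofReal_re, Complex.mul_re, Complex.mul_im, Complex.I_re,
    Complex.I_im, Complex.ofReal_im, Complex.log_im]
  ring

lemma stripMap_im (a c : ℝ) (w : ℂ) :
    (stripMap a c w).im = - log ‖(1 + w) / (1 - w)‖ / a := by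
  unfold stripMap
  rw [show Complex.I / (a : ℂ) = ((1 / a : ℝ) : ℂ) * Complex.I by push_cast; ring]
  simp only [Complex.sub_im, Complex.ofReal_re, Complex.mul_re, Complex.mul_im, Complex.I_re,
    Complex.I_im, Complex.ofReal_im, Complex.log_re]
  ring

lemma abs_stripMap_re_sub_lt {a : ℝ} (ha : 0 < a) (c : ℝ) {w : ℂ} (hw : ‖w‖ < 1) :
    |(stripMap a c w).re - c| < π / (2 * a) := by
  rw [stripMap_re, add_sub_cancel_left, abs_div, abs_of_pos ha, div_lt_div_iff₀ ha (by positivity)]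
  have := Complex.abs_arg_lt_pi_div_two_iff.2 (Or.inl (re_cayley_pos hw))
  nlinarith

lemma sin_stripAngle (a t : ℝ) : sin (stripAngle a t) = 1 / cosh (a * t) := by
  unfold stripAngle
  rw [sin_two_mul, sin_arctan, cos_arctan]
  have he := exp_pos (a * t)
  have : cosh (a * t) = (exp (a * t) ^ 2 + 1) / (2 * exp (a * t)) := by
    rw [cosh_eq, exp_neg]; field_simp
  rw [this]
  have h1 : √(1 + exp (a * t) ^ 2) ^ 2 = 1 + exp (a * t) ^ 2 := sq_sqrt (by positivity)
  have h2 : √(1 + exp (a * t) ^ 2) ≠ 0 := by positivity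
  field_simp
  rw [h1]; ring

lemma abs_sin_le_norm_one_sub (r θ : ℝ) : |sin θ| ≤ ‖1 - circleMap 0 r θ‖ := by
  refine abs_le_of_sq_le_sq ?_ (norm_nonneg _)
  rw [Complex.sq_norm, Complex.normSq_apply]
  simp only [circleMap_zero, Complex.sub_re, Complex.one_re, Complex.sub_im, Complex.one_im,
    Complex.re_ofReal_mul, Complex.im_ofReal_mul, Complex.exp_ofReal_mul_I_re,
    Complex.exp_ofReal_mul_I_im]
  nlinarith [sq_nonneg (r - cos θ), sin_sq_add_cos_sq θ]

lemma abs_sin_le_norm_one_add (r θ : ℝ) : |sin θ| ≤ ‖1 + circleMap 0 r θ‖ := by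
  have := abs_sin_le_norm_one_sub (-r) θ
  simpa [circleMap_zero] using this

/-- On the radius which ends at height `t`, the strip map has height at most `|t| + log 2 / a`. -/
lemma abs_stripMap_im_le {a : ℝ} (ha : 0 < a) (c t : ℝ) {r : ℝ} (hr : r ∈ Ioo 0 1) {θ : ℝ}
    (hθ : θ = stripAngle a t ∨ θ = - stripAngle a t) :
    |(stripMap a c (circleMap 0 r θ)).im| ≤ log 2 / a + |t| := by
  have hs : |sin θ| = 1 / cosh (a * t) := by
    have := cosh_pos (a * t)
    rcases hθ with rfl | rfl
    · rw [sin_stripAngle, abs_of_pos (by positivity)]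
    · rw [sin_neg, abs_neg, sin_stripAngle, abs_of_pos (by positivity)]
  have hc := cosh_pos (a * t)
  set w := circleMap 0 r θ with hw
  have hwn : ‖w‖ ≤ 1 := by rw [hw, norm_circleMap_zero, abs_of_pos hr.1]; exact hr.2.le
  have l1 : 1 / cosh (a * t) ≤ ‖1 - w‖ := hs ▸ abs_sin_le_norm_one_sub r θ
  have l2 : 1 / cosh (a * t) ≤ ‖1 + w‖ := hs ▸ abs_sin_le_norm_one_add r θ
  have u1 : ‖1 - w‖ ≤ 2 := (norm_sub_le _ _).trans (by rw [norm_one]; linarith)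
  have u2 : ‖1 + w‖ ≤ 2 := (norm_add_le _ _).trans (by rw [norm_one]; linarith)
  have hp : 0 < 1 / cosh (a * t) := by positivity
  have hl : log (1 / cosh (a * t)) ≥ - (a * |t|) := by
    rw [one_div, log_inv, ge_iff_le, neg_le_neg_iff, log_le_iff_le_exp hc, ← cosh_abs, cosh_eq,
      abs_mul, abs_of_pos ha]
    have : exp (-(a * |t|)) ≤ exp (a * |t|) := exp_le_exp.2 (by have := abs_nonneg t; nlinarith)
    linarith
  have a1 := log_le_log hp l1
  have a2 := log_le_log hp l2
  have a3 := log_le_log (hp.trans_le l1) u1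
  have a4 := log_le_log (hp.trans_le l2) u2
  rw [stripMap_im, norm_div, log_div (hp.trans_le l2).ne' (hp.trans_le l1).ne', abs_div, abs_neg,
    abs_of_pos ha, div_le_iff₀ ha, add_mul, div_mul_cancel₀ _ ha.ne', abs_le]
  constructor <;> nlinarith

lemma cayley_exp {α : ℝ} (hα : sin α ≠ 0) :
    (1 + circleMap 0 1 (2 * α)) / (1 - circleMap 0 1 (2 * α)) =
      ((cos α / sin α : ℝ) : ℂ) * Complex.I := by
  have e : circleMap 0 1 (2 * α) = (Complex.cos α + Complex.sin α * Complex.I) ^ 2 := by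
    rw [circleMap_zero, ← Complex.exp_mul_I, ← Complex.exp_nat_mul]; push_cast; ring_nf
  have h1 : (Complex.sin α) ^ 2 + Complex.cos α ^ 2 = 1 := Complex.sin_sq_add_cos_sq _
  have hs : Complex.sin α ≠ 0 := by rw [← Complex.ofReal_sin]; exact_mod_cast hα
  have hI := Complex.I_sq
  have e1 : 1 + circleMap 0 1 (2 * α) =
      2 * Complex.cos α * (Complex.cos α + Complex.sin α * Complex.I) := by
    rw [e]; linear_combination (-1 : ℂ) * h1 + Complex.sin α ^ 2 * hI
  have e2 : 1 - circleMap 0 1 (2 * α) =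
      -2 * Complex.I * Complex.sin α * (Complex.cos α + Complex.sin α * Complex.I) := by
    rw [e]; linear_combination (-1 : ℂ) * h1 + Complex.sin α ^ 2 * hI
  have h3 : Complex.cos α + Complex.sin α * Complex.I ≠ 0 := by
    rw [← Complex.exp_mul_I]; exact Complex.exp_ne_zero _
  rw [e1, e2, div_eq_iff (by simp [h3, hs])]
  push_cast
  field_simp
  linear_combination Complex.cos α * hI

lemma tendsto_circleMap_one (θ : ℝ) :
    Tendsto (fun r => circleMap 0 r θ) (𝓝[<] 1) (𝓝 (circleMap 0 1 θ)) := by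
  have : Continuous (fun r : ℝ => circleMap 0 r θ) := by
    simp only [circleMap_zero]; fun_prop
  exact (this.tendsto 1).mono_left nhdsWithin_le_nhds

lemma continuousAt_stripMap (a c : ℝ) {w : ℂ} (h : (1 + w) / (1 - w) ∈ Complex.slitPlane) :
    ContinuousAt (stripMap a c) w := by
  have h0 : 1 - w ≠ 0 := fun h0 => Complex.slitPlane_ne_zero h (by rw [h0, div_zero])
  unfold stripMap
  have : ContinuousAt (fun w : ℂ => (1 + w) / (1 - w)) w :=
    (by fun_prop : ContinuousAt (fun w : ℂ => 1 + w) w).div (by fun_prop) h0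
  exact continuousAt_const.sub (continuousAt_const.mul (this.clog h))

lemma cos_div_sin_arctan_exp (x : ℝ) : cos (arctan (exp x)) / sin (arctan (exp x)) = exp (-x) := by
  rw [← inv_div, ← tan_eq_sin_div_cos, tan_arctan, exp_neg]

lemma sin_arctan_exp_pos (x : ℝ) : 0 < sin (arctan (exp x)) := by
  rw [sin_arctan]; positivity

/-- Radial limits of the strip map on the upper half of the circle: the right-hand edge. -/
lemma tendsto_stripMap_right {a : ℝ} (ha : 0 < a) (c t : ℝ) :
    Tendsto (fun r => stripMap a c (circleMap 0 r (stripAngle a t))) (𝓝[<] 1)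
      (𝓝 (((c + π / (2 * a) : ℝ) : ℂ) + t * Complex.I)) := by
  have e : (1 + circleMap 0 1 (stripAngle a t)) / (1 - circleMap 0 1 (stripAngle a t)) =
      ((exp (-(a * t)) : ℝ) : ℂ) * Complex.I := by
    have e := cayley_exp (sin_arctan_exp_pos (a * t)).ne'
    rwa [cos_div_sin_arctan_exp] at e
  have hm : (1 + circleMap 0 1 (stripAngle a t)) / (1 - circleMap 0 1 (stripAngle a t)) ∈
      Complex.slitPlane := by
    rw [e]; right
    rw [Complex.im_ofReal_mul, Complex.I_im, mul_one]
    exact (exp_pos _).ne'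
  have h := (continuousAt_stripMap a c hm).tendsto.comp (tendsto_circleMap_one (stripAngle a t))
  have ha' : (a : ℂ) ≠ 0 := by exact_mod_cast ha.ne'
  have key : stripMap a c (circleMap 0 1 (stripAngle a t)) =
      ((c + π / (2 * a) : ℝ) : ℂ) + t * Complex.I := by
    unfold stripMap
    rw [e, Complex.log_ofReal_mul (exp_pos _) Complex.I_ne_zero, log_exp, Complex.log_I]
    push_cast
    field_simp
    linear_combination (-π : ℂ) * Complex.I_sq
  rwa [key] at h

/-- Radial limits of the strip map on the lower half of the circle: the left-hand edge. -/
lemma tendsto_stripMap_left {a : ℝ} (ha : 0 < a) (c t : ℝ) :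
    Tendsto (fun r => stripMap a c (circleMap 0 r (-stripAngle a t))) (𝓝[<] 1)
      (𝓝 (((c - π / (2 * a) : ℝ) : ℂ) + t * Complex.I)) := by
  have e : (1 + circleMap 0 1 (-stripAngle a t)) / (1 - circleMap 0 1 (-stripAngle a t)) =
      ((exp (-(a * t)) : ℝ) : ℂ) * (-Complex.I) := by
    have e := cayley_exp (α := -arctan (exp (a * t)))
      (by rw [sin_neg]; exact neg_ne_zero.2 (sin_arctan_exp_pos (a * t)).ne')
    rw [cos_neg, sin_neg, div_neg, cos_div_sin_arctan_exp] at e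
    rw [stripAngle, ← mul_neg, e]
    push_cast; ring
  have hm : (1 + circleMap 0 1 (-stripAngle a t)) / (1 - circleMap 0 1 (-stripAngle a t)) ∈
      Complex.slitPlane := by
    rw [e]; right
    rw [Complex.im_ofReal_mul, Complex.neg_im, Complex.I_im]
    exact mul_ne_zero (exp_pos _).ne' (by norm_num)
  have h := (continuousAt_stripMap a c hm).tendsto.comp (tendsto_circleMap_one (-stripAngle a t))
  have ha' : (a : ℂ) ≠ 0 := by exact_mod_cast ha.ne'
  have key : stripMap a c (circleMap 0 1 (-stripAngle a t)) =
      ((c - π / (2 * a) : ℝ) : ℂ) + t * Complex.I := by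
    unfold stripMap
    rw [e, Complex.log_ofReal_mul (exp_pos _) (neg_ne_zero.2 Complex.I_ne_zero), log_exp,
      Complex.log_neg_I]
    push_cast
    field_simp
    linear_combination (π : ℂ) * Complex.I_sq
  rwa [key] at h

lemma re_exp_strip_pos {a c : ℝ} (ha : 0 < a) {s : ℂ} (hs : |s.re - c| < π / (2 * a)) :
    0 < (Complex.exp (Complex.I * a * (s - c))).re ∧
    Complex.log (Complex.exp (Complex.I * a * (s - c))) = Complex.I * a * (s - c) := by
  have him : (Complex.I * a * (s - c)).im = a * (s.re - c) := by simp
  have h1 : |a * (s.re - c)| < π / 2 := by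
    rw [abs_mul, abs_of_pos ha]
    calc a * |s.re - c| < a * (π / (2 * a)) := by gcongr
      _ = π / 2 := by field_simp
  rw [abs_lt] at h1
  have := pi_pos
  constructor
  · rw [Complex.exp_re, him]
    exact mul_pos (exp_pos _) (cos_pos_of_mem_Ioo ⟨by linarith, by linarith⟩)
  · exact Complex.log_exp (by rw [him]; linarith) (by rw [him]; linarith)

lemma stripMap_stripInv {a c : ℝ} (ha : 0 < a) {s : ℂ} (hs : |s.re - c| < π / (2 * a)) :
    stripMap a c (stripInv a c s) = s := by
  obtain ⟨h1, h2⟩ := re_exp_strip_pos ha hs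
  set u := Complex.exp (Complex.I * a * (s - c)) with hu
  have hu1 : u + 1 ≠ 0 := fun h => by
    have := congrArg Complex.re h
    simp at this; linarith
  have e : (1 + (u - 1) / (u + 1)) / (1 - (u - 1) / (u + 1)) = u := by
    rw [one_add_div hu1, one_sub_div hu1, div_div_div_cancel_right₀ hu1]
    ring
  have ha' : (a : ℂ) ≠ 0 := by exact_mod_cast ha.ne'
  unfold stripMap stripInv
  rw [← hu, e, h2]
  field_simp
  linear_combination (c - s) * Complex.I_sq

lemma norm_stripInv_lt_one {a c : ℝ} (ha : 0 < a) {s : ℂ} (hs : |s.re - c| < π / (2 * a)) :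
    ‖stripInv a c s‖ < 1 := by
  obtain ⟨h1, -⟩ := re_exp_strip_pos ha hs
  unfold stripInv
  set u := Complex.exp (Complex.I * a * (s - c))
  have hu1 : u + 1 ≠ 0 := fun h => by
    have := congrArg Complex.re h
    simp at this; linarith
  rw [norm_div, div_lt_one (norm_pos_iff.2 hu1)]
  apply lt_of_pow_lt_pow_left₀ 2 (norm_nonneg _)
  rw [Complex.sq_norm, Complex.sq_norm, Complex.normSq_apply, Complex.normSq_apply]
  simp only [Complex.sub_re, Complex.one_re, Complex.sub_im, Complex.one_im, Complex.add_re,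
    Complex.add_im]
  nlinarith

lemma stripInv_stripMap {a c : ℝ} (ha : 0 < a) {w : ℂ} (hw : ‖w‖ < 1) :
    stripInv a c (stripMap a c w) = w := by
  have hne : (1 + w) / (1 - w) ≠ 0 := fun h => by
    have := re_cayley_pos hw
    rw [h] at this; simp at this
  have h0 := one_sub_ne_zero_of_norm_lt hw
  have ha' : (a : ℂ) ≠ 0 := by exact_mod_cast ha.ne'
  have e : Complex.I * a * (stripMap a c w - c) = Complex.log ((1 + w) / (1 - w)) := by
    unfold stripMap
    field_simp
    linear_combination (-Complex.log ((1 + w) / (1 - w))) * Complex.I_sq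
  unfold stripInv
  rw [e, Complex.exp_log hne, div_sub_one h0, div_add_one h0, div_div_div_cancel_right₀ h0]
  ring_nf

lemma differentiableAt_stripInv {a c : ℝ} (ha : 0 < a) {s : ℂ} (hs : |s.re - c| < π / (2 * a)) :
    DifferentiableAt ℂ (stripInv a c) s := by
  obtain ⟨h1, -⟩ := re_exp_strip_pos ha hs
  unfold stripInv
  refine DifferentiableAt.div (by fun_prop) (by fun_prop) (fun h => ?_)
  have := congrArg Complex.re h
  simp only [Complex.add_re, Complex.one_re, Complex.zero_re] at this
  linarith

/-- The logarithm of the pseudo-hyperbolic distance in the strip between its centre and a real point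
at distance `x - b` from the left edge. With `x = 1` this is the contribution of the pole of `ζ`. -/
lemma log_norm_stripInv_ofReal {a b x : ℝ} (ha : 0 < a) (h0 : 0 < a * (x - b))
    (h1 : a * (x - b) < π / 2) :
    log ‖stripInv a (b + π / (2 * a)) x‖ =
      1 / 2 * log ((1 - sin (a * (x - b))) / (1 + sin (a * (x - b)))) := by
  set φ := a * (x - b) with hφ
  have e : Complex.I * a * ((x : ℂ) - ((b + π / (2 * a) : ℝ) : ℂ)) =
      ((φ - π / 2 : ℝ) : ℂ) * Complex.I := by
    have ha' : (a : ℂ) ≠ 0 := by exact_mod_cast ha.ne'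
    rw [hφ]; push_cast; field_simp
    ring
  have hs1 : sin φ < 1 := by
    rw [← sin_pi_div_two]
    exact sin_lt_sin_of_lt_of_le_pi_div_two (by linarith) le_rfl h1
  have hs0 : 0 < sin φ := sin_pos_of_pos_of_lt_pi h0 (by linarith [pi_pos])
  have hsq : ‖stripInv a (b + π / (2 * a)) x‖ ^ 2 = (1 - sin φ) / (1 + sin φ) := by
    unfold stripInv
    rw [e, norm_div, div_pow, Complex.sq_norm, Complex.sq_norm, Complex.normSq_apply,
      Complex.normSq_apply]
    simp only [Complex.sub_re, Complex.one_re, Complex.sub_im, Complex.one_im, Complex.add_re,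
      Complex.add_im, Complex.exp_ofReal_mul_I_re, Complex.exp_ofReal_mul_I_im, cos_sub_pi_div_two,
      sin_sub_pi_div_two]
    have h2 := sin_sq_add_cos_sq φ
    rw [div_eq_div_iff (by nlinarith) (by linarith)]
    linear_combination (2 * sin φ) * h2
  rw [← hsq, log_pow]
  push_cast; ring

/-! ### Passage to the boundary of the strip -/

/-- The weighted mean of `log ‖f‖` over the vertical line `Re s = β`, with the hyperbolic secant
weight of parameter `a` (of total mass `1 / 2`). -/
noncomputable def logLineMean (a : ℝ) (f : ℂ → ℂ) (β : ℝ) : ℝ :=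
  ∫ t, sechKernel a t * log ‖f (β + t * Complex.I)‖

/-- A form of Fatou's lemma: functions with a common integrable majorant, whose limit superior is
bounded by `u` and whose integrals do not fall below a convergent sequence. -/
lemma integrable_and_le_integral_of_limsup_le {v : ℕ → ℝ → ℝ} {u G : ℝ → ℝ} {ℓ : ℕ → ℝ} {L : ℝ}
    (hu : AEStronglyMeasurable u) (hv : ∀ n, Integrable (v n)) (hG : Integrable G)
    (hvG : ∀ n x, v n x ≤ G x) (huG : ∀ x, u x ≤ G x)
    (hlim : ∀ x, ∀ ε > 0, ∀ᶠ n in atTop, v n x ≤ u x + ε)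
    (hℓ : ∀ n, ℓ n ≤ ∫ x, v n x) (hL : Tendsto ℓ atTop (𝓝 L)) :
    Integrable u ∧ L ≤ ∫ x, u x := by
  have hLG : L ≤ ∫ x, G x :=
    le_of_tendsto' hL fun n => (hℓ n).trans (integral_mono (hv n) hG (hvG n))
  have hF : ∫⁻ x, ENNReal.ofReal (G x - u x) ≤ ENNReal.ofReal ((∫ x, G x) - L) := by
    calc ∫⁻ x, ENNReal.ofReal (G x - u x)
        ≤ ∫⁻ x, liminf (fun n => ENNReal.ofReal (G x - v n x)) atTop := by
          refine lintegral_mono fun x => ?_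
          refine ENNReal.le_of_forall_pos_le_add fun ε hε _ => ?_
          have h1 : ENNReal.ofReal (G x - u x - ε) ≤
              liminf (fun n => ENNReal.ofReal (G x - v n x)) atTop := by
            refine le_liminf_of_le (by isBoundedDefault) ?_
            filter_upwards [hlim x ε (by exact_mod_cast hε)] with n hn
            exact ENNReal.ofReal_le_ofReal (by linarith)
          calc ENNReal.ofReal (G x - u x) = ENNReal.ofReal ((G x - u x - ε) + ε) := by ring_nf
            _ ≤ ENNReal.ofReal (G x - u x - ε) + ENNReal.ofReal ε := ENNReal.ofReal_add_le
            _ ≤ _ := by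
              rw [ENNReal.ofReal_coe_nnreal]; gcongr
      _ ≤ liminf (fun n => ∫⁻ x, ENNReal.ofReal (G x - v n x)) atTop :=
          lintegral_liminf_le' fun n =>
            ((hG.sub (hv n)).aestronglyMeasurable.aemeasurable).ennreal_ofReal
      _ ≤ liminf (fun n => ENNReal.ofReal ((∫ x, G x) - ℓ n)) atTop := by
          refine liminf_le_liminf (Eventually.of_forall fun n => ?_)
          rw [← ofReal_integral_eq_lintegral_ofReal (f := fun x => G x - v n x) (hG.sub (hv n))
            (Eventually.of_forall fun x => sub_nonneg.2 (hvG n x)), integral_sub hG (hv n)]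
          exact ENNReal.ofReal_le_ofReal (by linarith [hℓ n])
      _ = ENNReal.ofReal ((∫ x, G x) - L) :=
          (ENNReal.tendsto_ofReal (hL.const_sub _)).liminf_eq
  have hGu : Integrable (fun x => G x - u x) := by
    refine ⟨hG.aestronglyMeasurable.sub hu, ?_⟩
    rw [hasFiniteIntegral_iff_ofReal (Eventually.of_forall fun x => sub_nonneg.2 (huG x))]
    exact hF.trans_lt ENNReal.ofReal_lt_top
  have hui : Integrable u := by
    refine (hG.sub hGu).congr (Eventually.of_forall fun x => ?_)
    simp only [Pi.sub_apply]; ring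
  refine ⟨hui, ?_⟩
  rw [← ofReal_integral_eq_lintegral_ofReal hGu
    (Eventually.of_forall fun x => sub_nonneg.2 (huG x)), integral_sub hG hui,
    ENNReal.ofReal_le_ofReal_iff (by linarith)] at hF
  linarith

/-- `log ‖f‖` is upper semicontinuous, also with the convention `log 0 = 0`. -/
lemma eventually_log_norm_le_add {ι : Type*} {l : Filter ι} {f : ℂ → ℂ} (hf : Continuous f)
    {s : ι → ℂ} {s₀ : ℂ} (hs : Tendsto s l (𝓝 s₀)) {ε : ℝ} (hε : 0 < ε) :
    ∀ᶠ i in l, log ‖f (s i)‖ ≤ log ‖f s₀‖ + ε := by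
  have h : Tendsto (fun i => ‖f (s i)‖) l (𝓝 ‖f s₀‖) := ((hf.tendsto s₀).comp hs).norm
  by_cases h0 : ‖f s₀‖ = 0
  · rw [h0, log_zero]
    rw [h0] at h
    filter_upwards [h.eventually (gt_mem_nhds one_pos)] with i hi
    have := log_nonpos (norm_nonneg (f (s i))) hi.le
    linarith
  · have h2 := ((continuousAt_log h0).tendsto.comp h).eventually
      (gt_mem_nhds (lt_add_of_pos_right _ hε))
    filter_upwards [h2] with i hi using le_of_lt hi

lemma analyticOnNhd_comp_stripMap {f : ℂ → ℂ} (hf : Differentiable ℂ f) (a c : ℝ) :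
    AnalyticOnNhd ℂ (fun w => f (stripMap a c w)) (Metric.ball 0 1) := by
  refine DifferentiableOn.analyticOnNhd (fun w hw => ?_) Metric.isOpen_ball
  have hw' : ‖w‖ < 1 := by simpa using hw
  exact ((hf _).comp w (differentiableAt_stripMap a c hw')).differentiableWithinAt

lemma closedBall_subset_unit_ball {r : ℝ} (hr : r ∈ Ioo 0 1) :
    Metric.closedBall (0 : ℂ) |r| ⊆ Metric.ball 0 1 := by
  rw [abs_of_pos hr.1]; exact Metric.closedBall_subset_ball hr.2

lemma circleIntegrable_log_norm_comp_stripMap {f : ℂ → ℂ} (hf : Differentiable ℂ f) (a c : ℝ)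
    {r : ℝ} (hr : r ∈ Ioo 0 1) :
    CircleIntegrable (fun w => log ‖f (stripMap a c w)‖) 0 r :=
  MeromorphicOn.circleIntegrable_log_norm
    (((analyticOnNhd_comp_stripMap hf a c).mono
      (Metric.sphere_subset_closedBall.trans (closedBall_subset_unit_ball hr))).meromorphicOn)

lemma norm_circleMap_lt_one {r : ℝ} (hr : r ∈ Ioo 0 1) (θ : ℝ) : ‖circleMap 0 r θ‖ < 1 := by
  rw [norm_circleMap_zero, abs_of_pos hr.1]; exact hr.2

lemma measurable_log_norm_line {f : ℂ → ℂ} (hf : Continuous f) (β : ℝ) :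
    Measurable (fun t : ℝ => log ‖f (β + t * Complex.I)‖) := by
  have : Continuous (fun t : ℝ => ‖f (β + t * Complex.I)‖) := by fun_prop
  exact measurable_log.comp this.measurable

lemma one_add_abs_im_stripMap_le {a : ℝ} (ha : 0 < a) (c t : ℝ) {r : ℝ} (hr : r ∈ Ioo 0 1) {θ : ℝ}
    (hθ : θ = stripAngle a t ∨ θ = - stripAngle a t) :
    1 + |(stripMap a c (circleMap 0 r θ)).im| ≤ (1 + log 2 / a) * (1 + |t|) := by
  have h := abs_stripMap_im_le ha c t hr hθ
  have h2 : 0 ≤ log 2 / a * |t| := by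
    have := log_nonneg one_le_two; positivity
  nlinarith

/-- Passage to the boundary of the strip, in the form of an inequality: lower bounds for the
averages of `log ‖f‖` over the images of the circles `‖w‖ = r` bound the means over the boundary
lines from below. Zeros of `f` on the boundary are allowed. -/
lemma integrable_and_le_logLineMean_add {a c C r₀ L : ℝ} {f : ℂ → ℂ} {ℓ : ℝ → ℝ} (ha : 0 < a)
    (hf : Differentiable ℂ f) (hC : 0 ≤ C)
    (hfC : ∀ s : ℂ, |s.re - c| ≤ π / (2 * a) → log ‖f s‖ ≤ C * (1 + |s.im|))
    (hr₀ : r₀ ∈ Ico 0 1)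
    (hℓ : ∀ r ∈ Ioo r₀ 1, ℓ r ≤ circleAverage (fun w => log ‖f (stripMap a c w)‖) 0 r)
    (hL : Tendsto ℓ (𝓝[<] 1) (𝓝 L)) :
    Integrable (fun t => sechKernel a t * log ‖f ((c - π / (2 * a) : ℝ) + t * Complex.I)‖) ∧
    Integrable (fun t => sechKernel a t * log ‖f ((c + π / (2 * a) : ℝ) + t * Complex.I)‖) ∧
    L ≤ logLineMean a f (c - π / (2 * a)) + logLineMean a f (c + π / (2 * a)) := by
  set βl := c - π / (2 * a) with hβl
  set βr := c + π / (2 * a) with hβr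
  have hw : 0 < π / (2 * a) := by positivity
  set C₁ := C * (1 + log 2 / a) with hC₁
  have hl2 : 0 ≤ log 2 / a := div_nonneg (log_nonneg one_le_two) ha.le
  have hCC₁ : C ≤ C₁ := by rw [hC₁]; nlinarith
  have hC₁0 : 0 ≤ C₁ := hC.trans hCC₁
  have hκ := fun t => sechKernel_pos ha t
  have hbl : ∀ t : ℝ, log ‖f (βl + t * Complex.I)‖ ≤ C₁ * (1 + |t|) := fun t => by
    have := hfC (βl + t * Complex.I) (by
      have e : ((βl : ℂ) + t * Complex.I).re = βl := by simp
      rw [e, abs_le]; constructor <;> linarith)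
    simp only [Complex.add_im, Complex.ofReal_im, Complex.mul_im, Complex.ofReal_re, Complex.I_im,
      Complex.I_re, mul_one, mul_zero, add_zero, zero_add] at this
    exact this.trans (by gcongr)
  have hbr : ∀ t : ℝ, log ‖f (βr + t * Complex.I)‖ ≤ C₁ * (1 + |t|) := fun t => by
    have := hfC (βr + t * Complex.I) (by
      have e : ((βr : ℂ) + t * Complex.I).re = βr := by simp
      rw [e, abs_le]; constructor <;> linarith)
    simp only [Complex.add_im, Complex.ofReal_im, Complex.mul_im, Complex.ofReal_re, Complex.I_im,
      Complex.I_re, mul_one, mul_zero, add_zero, zero_add] at this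
    exact this.trans (by gcongr)
  have hin : ∀ (t : ℝ) (r : ℝ), r ∈ Ioo 0 1 → ∀ θ : ℝ,
      (θ = stripAngle a t ∨ θ = - stripAngle a t) →
      log ‖f (stripMap a c (circleMap 0 r θ))‖ ≤ C₁ * (1 + |t|) := fun t r hr θ hθ => by
    have h1 := hfC _ (abs_stripMap_re_sub_lt ha c (norm_circleMap_lt_one hr θ)).le
    have h2 := one_add_abs_im_stripMap_le ha c t hr hθ
    calc _ ≤ _ := h1
      _ ≤ C * ((1 + log 2 / a) * (1 + |t|)) := by gcongr
      _ = _ := by rw [hC₁]; ring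
  -- radii which increase to `1`
  set ρ : ℕ → ℝ := fun n => 1 - (1 - r₀) / (n + 2) with hρ
  have hρ1 : ∀ n, ρ n ∈ Ioo r₀ 1 := fun n => by
    have h1 : 0 < 1 - r₀ := by linarith [hr₀.2]
    have h2 : (1 - r₀) / ((n : ℝ) + 2) < 1 - r₀ := div_lt_self h1 (by
      have := n.cast_nonneg (α := ℝ); linarith)
    have h3 : 0 < (1 - r₀) / ((n : ℝ) + 2) := by positivity
    constructor <;> simp only [hρ] <;> linarith
  have hρ0 : ∀ n, ρ n ∈ Ioo (0 : ℝ) 1 := fun n => ⟨hr₀.1.trans_lt (hρ1 n).1, (hρ1 n).2⟩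
  have hρlim : Tendsto ρ atTop (𝓝[<] 1) := by
    refine tendsto_nhdsWithin_iff.2 ⟨?_, Eventually.of_forall fun n => (hρ1 n).2⟩
    have h1 : Tendsto (fun n : ℕ => (1 - r₀) / ((n : ℝ) + 2)) atTop (𝓝 0) :=
      (tendsto_const_nhds).div_atTop
        (tendsto_atTop_add_const_right _ _ tendsto_natCast_atTop_atTop)
    simpa [hρ] using h1.const_sub 1
  obtain ⟨hI, hle⟩ := integrable_and_le_integral_of_limsup_le
    (v := fun n t => sechKernel a t * (log ‖f (stripMap a c (circleMap 0 (ρ n) (stripAngle a t)))‖ +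
      log ‖f (stripMap a c (circleMap 0 (ρ n) (-stripAngle a t)))‖))
    (u := fun t => sechKernel a t * (log ‖f (βr + t * Complex.I)‖ + log ‖f (βl + t * Complex.I)‖))
    (G := fun t => (2 * C₁) * (sechKernel a t * (1 + |t|))) (ℓ := fun n => ℓ (ρ n)) (L := L)
    ((continuous_sechKernel a).measurable.mul ((measurable_log_norm_line hf.continuous βr).add
      (measurable_log_norm_line hf.continuous βl))).aestronglyMeasurable
    (fun n => by
      obtain ⟨h1, h2⟩ := integrable_sechKernel_mul_of_circleIntegrable ha
        (circleIntegrable_log_norm_comp_stripMap hf a c (hρ0 n))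
      simp only [mul_add]; exact h1.add h2)
    ((integrable_sechKernel_mul_one_add_abs ha).const_mul _)
    (fun n t => by
      have h1 := hin t _ (hρ0 n) _ (Or.inl rfl)
      have h2 := hin t _ (hρ0 n) _ (Or.inr rfl)
      have h3 := hκ t
      calc _ ≤ sechKernel a t * (C₁ * (1 + |t|) + C₁ * (1 + |t|)) := by gcongr
        _ = _ := by ring)
    (fun t => by
      have h1 := hbl t
      have h2 := hbr t
      have h3 := hκ t
      calc _ ≤ sechKernel a t * (C₁ * (1 + |t|) + C₁ * (1 + |t|)) := by gcongr
        _ = _ := by ring)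
    (fun t ε hε => by
      have h3 := hκ t
      have hε' : 0 < ε / (2 * sechKernel a t) := by positivity
      have h1 := eventually_log_norm_le_add hf.continuous
        ((tendsto_stripMap_right ha c t).comp hρlim) hε'
      have h2 := eventually_log_norm_le_add hf.continuous
        ((tendsto_stripMap_left ha c t).comp hρlim) hε'
      filter_upwards [h1, h2] with n h1 h2
      have h4 := mul_le_mul_of_nonneg_left (add_le_add h1 h2) h3.le
      refine h4.trans (le_of_eq ?_)
      have h5 : sechKernel a t * (ε / (2 * sechKernel a t)) = ε / 2 := by field_simp
      linear_combination 2 * h5)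
    (fun n => by
      rw [← circleAverage_eq_integral_sechKernel ha
        (F := fun w => log ‖f (stripMap a c w)‖)
        (circleIntegrable_log_norm_comp_stripMap hf a c (hρ0 n))]
      exact hℓ _ (hρ1 n))
    (hL.comp hρlim)
  have hG := (integrable_sechKernel_mul_one_add_abs ha).const_mul C₁
  have hIl : Integrable (fun t => sechKernel a t * log ‖f (βl + t * Complex.I)‖) := by
    refine integrable_of_le_of_le (g₁ := fun t => sechKernel a t *
      (log ‖f (βr + t * Complex.I)‖ + log ‖f (βl + t * Complex.I)‖) -
      C₁ * (sechKernel a t * (1 + |t|))) (g₂ := fun t => C₁ * (sechKernel a t * (1 + |t|)))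
      ((continuous_sechKernel a).measurable.mul
        (measurable_log_norm_line hf.continuous βl)).aestronglyMeasurable
      (Eventually.of_forall fun t => ?_) (Eventually.of_forall fun t => ?_) (hI.sub hG) hG
    · have h1 := mul_le_mul_of_nonneg_left (hbr t) (hκ t).le
      simp only; linarith
    · have h1 := mul_le_mul_of_nonneg_left (hbl t) (hκ t).le
      simp only; linarith
  have hIr : Integrable (fun t => sechKernel a t * log ‖f (βr + t * Complex.I)‖) := by
    refine (hI.sub hIl).congr (Eventually.of_forall fun t => ?_)
    simp only [Pi.sub_apply]; ring
  refine ⟨hIl, hIr, hle.trans (le_of_eq ?_)⟩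
  simp_rw [mul_add]
  rw [integral_add hIr hIl, add_comm]
  rfl

/-- Passage to the boundary of the strip by dominated convergence, when `log ‖f‖` is controlled from
both sides near the boundary and `f` has no zero on it. -/
lemma tendsto_circleAverage_logLineMean_add {a c C r₀ : ℝ} {f : ℂ → ℂ} (ha : 0 < a)
    (hf : Differentiable ℂ f) (hC : 0 ≤ C) (hr₀ : r₀ ∈ Ico 0 1)
    (hfC : ∀ w : ℂ, r₀ < ‖w‖ → ‖w‖ < 1 →
      |log ‖f (stripMap a c w)‖| ≤ C * (1 + |(stripMap a c w).im|))
    (hl : ∀ t : ℝ, f ((c - π / (2 * a) : ℝ) + t * Complex.I) ≠ 0)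
    (hr : ∀ t : ℝ, f ((c + π / (2 * a) : ℝ) + t * Complex.I) ≠ 0) :
    Integrable (fun t => sechKernel a t * log ‖f ((c - π / (2 * a) : ℝ) + t * Complex.I)‖) ∧
    Integrable (fun t => sechKernel a t * log ‖f ((c + π / (2 * a) : ℝ) + t * Complex.I)‖) ∧
    Tendsto (fun r => circleAverage (fun w => log ‖f (stripMap a c w)‖) 0 r) (𝓝[<] 1)
      (𝓝 (logLineMean a f (c - π / (2 * a)) + logLineMean a f (c + π / (2 * a)))) := by
  set βl := c - π / (2 * a) with hβl
  set βr := c + π / (2 * a) with hβr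
  set C₁ := C * (1 + log 2 / a) with hC₁
  have hκ := fun t => sechKernel_pos ha t
  have hin : ∀ (t : ℝ) (r : ℝ), r ∈ Ioo r₀ 1 → ∀ θ : ℝ,
      (θ = stripAngle a t ∨ θ = - stripAngle a t) →
      |log ‖f (stripMap a c (circleMap 0 r θ))‖| ≤ C₁ * (1 + |t|) := fun t r hr θ hθ => by
    have hr' : r ∈ Ioo (0 : ℝ) 1 := ⟨hr₀.1.trans_lt hr.1, hr.2⟩
    have h1 := hfC (circleMap 0 r θ) (by rw [norm_circleMap_zero, abs_of_pos hr'.1]; exact hr.1)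
      (norm_circleMap_lt_one hr' θ)
    have h2 := one_add_abs_im_stripMap_le ha c t hr' hθ
    calc _ ≤ _ := h1
      _ ≤ C * ((1 + log 2 / a) * (1 + |t|)) := by gcongr
      _ = _ := by rw [hC₁]; ring
  have hev : ∀ᶠ r in 𝓝[<] (1 : ℝ), r ∈ Ioo r₀ 1 := Ioo_mem_nhdsLT hr₀.2
  have hlimr : ∀ t : ℝ, Tendsto (fun r => log ‖f (stripMap a c (circleMap 0 r (stripAngle a t)))‖)
      (𝓝[<] 1) (𝓝 (log ‖f (βr + t * Complex.I)‖)) := fun t =>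
    (continuousAt_log (norm_ne_zero_iff.2 (hr t))).tendsto.comp
      ((hf.continuous.tendsto _).comp (tendsto_stripMap_right ha c t)).norm
  have hliml : ∀ t : ℝ, Tendsto (fun r => log ‖f (stripMap a c (circleMap 0 r (-stripAngle a t)))‖)
      (𝓝[<] 1) (𝓝 (log ‖f (βl + t * Complex.I)‖)) := fun t =>
    (continuousAt_log (norm_ne_zero_iff.2 (hl t))).tendsto.comp
      ((hf.continuous.tendsto _).comp (tendsto_stripMap_left ha c t)).norm
  have hG := (integrable_sechKernel_mul_one_add_abs ha).const_mul C₁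
  have hbr : ∀ t : ℝ, |log ‖f (βr + t * Complex.I)‖| ≤ C₁ * (1 + |t|) := fun t =>
    le_of_tendsto (hlimr t).abs (hev.mono fun r hr => hin t r hr _ (Or.inl rfl))
  have hbl : ∀ t : ℝ, |log ‖f (βl + t * Complex.I)‖| ≤ C₁ * (1 + |t|) := fun t =>
    le_of_tendsto (hliml t).abs (hev.mono fun r hr => hin t r hr _ (Or.inr rfl))
  have hInt : ∀ β : ℝ, (∀ t : ℝ, |log ‖f (β + t * Complex.I)‖| ≤ C₁ * (1 + |t|)) →
      Integrable (fun t => sechKernel a t * log ‖f (β + t * Complex.I)‖) := fun β hb => by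
    refine hG.mono' ((continuous_sechKernel a).measurable.mul
      (measurable_log_norm_line hf.continuous β)).aestronglyMeasurable
      (Eventually.of_forall fun t => ?_)
    rw [norm_mul, norm_of_nonneg (hκ t).le, Real.norm_eq_abs]
    have := mul_le_mul_of_nonneg_left (hb t) (hκ t).le
    linarith
  refine ⟨hInt _ hbl, hInt _ hbr, ?_⟩
  have e : logLineMean a f βl + logLineMean a f βr = ∫ t, sechKernel a t *
      (log ‖f (βr + t * Complex.I)‖ + log ‖f (βl + t * Complex.I)‖) := by
    simp_rw [mul_add]
    rw [integral_add (hInt _ hbr) (hInt _ hbl), add_comm]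
    rfl
  rw [e]
  have h := tendsto_integral_filter_of_dominated_convergence (μ := volume) (l := 𝓝[<] (1 : ℝ))
    (F := fun r t => sechKernel a t * (log ‖f (stripMap a c (circleMap 0 r (stripAngle a t)))‖ +
      log ‖f (stripMap a c (circleMap 0 r (-stripAngle a t)))‖))
    (f := fun t => sechKernel a t * (log ‖f (βr + t * Complex.I)‖ + log ‖f (βl + t * Complex.I)‖))
    (fun t => 2 * (C₁ * (sechKernel a t * (1 + |t|)))) ?_ ?_ (hG.const_mul 2)
    (Eventually.of_forall fun t => ((hlimr t).add (hliml t)).const_mul _)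
  · refine h.congr' ?_
    filter_upwards [hev] with r hr
    exact (circleAverage_eq_integral_sechKernel ha (F := fun w => log ‖f (stripMap a c w)‖)
      (circleIntegrable_log_norm_comp_stripMap hf a c ⟨hr₀.1.trans_lt hr.1, hr.2⟩)).symm
  · filter_upwards [hev] with r hr
    obtain ⟨h1, h2⟩ := integrable_sechKernel_mul_of_circleIntegrable ha
      (circleIntegrable_log_norm_comp_stripMap hf a c ⟨hr₀.1.trans_lt hr.1, hr.2⟩)
    have := (h1.add h2).aestronglyMeasurable
    refine this.congr (Eventually.of_forall fun t => ?_)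
    simp only [Pi.add_apply]; ring
  · filter_upwards [hev] with r hr
    refine Eventually.of_forall fun t => ?_
    rw [norm_mul, norm_of_nonneg (hκ t).le, Real.norm_eq_abs]
    have h1 := hin t r hr _ (Or.inl rfl)
    have h2 := hin t r hr _ (Or.inr rfl)
    have h3 := hκ t
    calc _ ≤ sechKernel a t * (C₁ * (1 + |t|) + C₁ * (1 + |t|)) := by
          gcongr
          exact (abs_add_le _ _).trans (add_le_add h1 h2)
      _ = _ := by ring

/-! ### Jensen's formula in a strip -/

/-- The part of Jensen's formula used here: a zero `w₀` in the disc raises the average of `log ‖g‖`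
over the circle above its value at the centre by at least `log (r / ‖w₀‖)`. -/
lemma log_norm_add_log_le_circleAverage {g : ℂ → ℂ} {r : ℝ} (hr : 0 < r)
    (hg : AnalyticOnNhd ℂ g (Metric.closedBall 0 |r|)) (hg0 : g 0 ≠ 0) {w₀ : ℂ} (hw₀ : ‖w₀‖ ≤ r)
    (hgw₀ : g w₀ = 0) :
    log ‖g 0‖ + log (r / ‖w₀‖) ≤ circleAverage (fun w => log ‖g w‖) 0 r := by
  rw [hg.circleAverage_log_norm hr.ne' hg0, add_comm]
  gcongr
  set D := MeromorphicOn.divisor g (Metric.closedBall 0 |r|) with hD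
  have hDnn : ∀ u, 0 ≤ D u := MeromorphicOn.AnalyticOnNhd.divisor_nonneg hg
  have hlog : ∀ u ∈ Metric.closedBall (0 : ℂ) |r|, 0 ≤ log (r * ‖0 - u‖⁻¹) := fun u hu => by
    rw [zero_sub, norm_neg]
    rcases eq_or_ne u 0 with rfl | h0
    · simp
    · apply log_nonneg
      rw [← div_eq_mul_inv, one_le_div (norm_pos_iff.2 h0)]
      simpa [abs_of_pos hr] using hu
  have hterm : ∀ u, 0 ≤ (D u : ℝ) * log (r * ‖0 - u‖⁻¹) := fun u => by
    by_cases hu : u ∈ Metric.closedBall (0 : ℂ) |r|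
    · exact mul_nonneg (by exact_mod_cast hDnn u) (hlog u hu)
    · rw [D.apply_eq_zero_of_notMem hu]; simp
  have hfin : (Function.support fun u => (D u : ℝ) * log (r * ‖0 - u‖⁻¹)).Finite :=
    (D.finiteSupport (isCompact_closedBall 0 |r|)).subset fun u hu => by
      simp only [Function.mem_support] at hu ⊢
      intro h; apply hu; rw [h]; simp
  have hw₀' : w₀ ∈ Metric.closedBall (0 : ℂ) |r| := by simpa [abs_of_pos hr] using hw₀
  have hD1 : 1 ≤ D w₀ := by
    rw [hD, MeromorphicOn.AnalyticOnNhd.divisor_apply hg hw₀']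
    have h1 : analyticOrderAt g w₀ ≠ 0 := by
      rw [(hg w₀ hw₀').analyticOrderAt_ne_zero]; exact hgw₀
    have h2 : analyticOrderAt g w₀ ≠ ⊤ := fun h => by
      rw [analyticOrderAt_eq_top] at h
      have := hg.eqOn_zero_of_preconnected_of_eventuallyEq_zero
        (convex_closedBall 0 |r|).isPreconnected hw₀' h (by simp : (0 : ℂ) ∈ _)
      exact hg0 this
    obtain ⟨n, hn⟩ := ENat.ne_top_iff_exists.1 h2
    rw [← hn] at h1 ⊢
    have h3 : 1 ≤ n := Nat.one_le_iff_ne_zero.2 (by exact_mod_cast h1)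
    simpa using! h3
  calc log (r / ‖w₀‖) = 1 * log (r * ‖0 - w₀‖⁻¹) := by
        rw [zero_sub, norm_neg, div_eq_mul_inv, one_mul]
    _ ≤ D w₀ * log (r * ‖0 - w₀‖⁻¹) := by
        gcongr
        · exact hlog w₀ hw₀'
        · exact_mod_cast hD1
    _ ≤ _ := single_le_finsum w₀ hfin hterm

lemma log_norm_le_circleAverage {g : ℂ → ℂ} {r : ℝ} (hr : 0 < r)
    (hg : AnalyticOnNhd ℂ g (Metric.closedBall 0 |r|)) (hg0 : g 0 ≠ 0) :
    log ‖g 0‖ ≤ circleAverage (fun w => log ‖g w‖) 0 r := by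
  rw [hg.circleAverage_log_norm hr.ne' hg0]
  refine le_add_of_nonneg_left (finsum_nonneg fun u => ?_)
  set D := MeromorphicOn.divisor g (Metric.closedBall 0 |r|) with hD
  have hDnn : ∀ u, 0 ≤ D u := MeromorphicOn.AnalyticOnNhd.divisor_nonneg hg
  by_cases hu : u ∈ Metric.closedBall (0 : ℂ) |r|
  · refine mul_nonneg (by exact_mod_cast hDnn u) ?_
    rw [zero_sub, norm_neg]
    rcases eq_or_ne u 0 with rfl | h0
    · simp
    · apply log_nonneg
      rw [← div_eq_mul_inv, one_le_div (norm_pos_iff.2 h0)]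
      simpa [abs_of_pos hr] using hu
  · rw [D.apply_eq_zero_of_notMem hu]; simp

/-- Subharmonicity of `log ‖f‖` in a strip. -/
lemma log_norm_le_logLineMean_add {a c C : ℝ} {f : ℂ → ℂ} (ha : 0 < a)
    (hf : Differentiable ℂ f) (hC : 0 ≤ C)
    (hfC : ∀ s : ℂ, |s.re - c| ≤ π / (2 * a) → log ‖f s‖ ≤ C * (1 + |s.im|)) (hfc : f c ≠ 0) :
    Integrable (fun t => sechKernel a t * log ‖f ((c - π / (2 * a) : ℝ) + t * Complex.I)‖) ∧
    Integrable (fun t => sechKernel a t * log ‖f ((c + π / (2 * a) : ℝ) + t * Complex.I)‖) ∧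
    log ‖f c‖ ≤ logLineMean a f (c - π / (2 * a)) + logLineMean a f (c + π / (2 * a)) := by
  refine integrable_and_le_logLineMean_add (r₀ := 0) (ℓ := fun _ => log ‖f c‖) ha hf hC hfC
    (by simp) (fun r hr => ?_) tendsto_const_nhds
  have h := log_norm_le_circleAverage (g := fun w => f (stripMap a c w)) hr.1
    ((analyticOnNhd_comp_stripMap hf a c).mono (closedBall_subset_unit_ball hr))
    (by simpa [stripMap_zero] using hfc)
  simpa [stripMap_zero] using h

/-- A zero in the interior of the strip makes the mean value inequality strict. -/
lemma log_norm_lt_logLineMean_add {a c C : ℝ} {f : ℂ → ℂ} (ha : 0 < a)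
    (hf : Differentiable ℂ f) (hC : 0 ≤ C)
    (hfC : ∀ s : ℂ, |s.re - c| ≤ π / (2 * a) → log ‖f s‖ ≤ C * (1 + |s.im|)) (hfc : f c ≠ 0)
    {z : ℂ} (hz : |z.re - c| < π / (2 * a)) (hfz : f z = 0) :
    log ‖f c‖ < logLineMean a f (c - π / (2 * a)) + logLineMean a f (c + π / (2 * a)) := by
  set w₀ := stripInv a c z with hw₀
  have hw₀1 : ‖w₀‖ < 1 := norm_stripInv_lt_one ha hz
  have hw₀z : stripMap a c w₀ = z := stripMap_stripInv ha hz
  have hw₀0 : 0 < ‖w₀‖ := by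
    rw [norm_pos_iff]
    intro h
    rw [h, stripMap_zero] at hw₀z
    rw [hw₀z] at hfc; exact hfc hfz
  have hpos : 0 < log (1 / ‖w₀‖) := log_pos (by rw [one_lt_div hw₀0]; exact hw₀1)
  have h := (integrable_and_le_logLineMean_add (r₀ := ‖w₀‖)
    (ℓ := fun r => log ‖f c‖ + log (r / ‖w₀‖)) (L := log ‖f c‖ + log (1 / ‖w₀‖)) ha hf hC hfC
    ⟨norm_nonneg _, hw₀1⟩ (fun r hr => ?_) ?_).2.2
  · linarith
  · have hr' : r ∈ Ioo (0 : ℝ) 1 := ⟨hw₀0.trans hr.1, hr.2⟩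
    have h := log_norm_add_log_le_circleAverage (g := fun w => f (stripMap a c w)) hr'.1
      ((analyticOnNhd_comp_stripMap hf a c).mono (closedBall_subset_unit_ball hr'))
      (by simpa [stripMap_zero] using hfc) hr.1.le (by rw [hw₀z]; exact hfz)
    simpa [stripMap_zero] using h
  · have h1 : ContinuousAt (fun r : ℝ => log ‖f c‖ + log (r / ‖w₀‖)) 1 := by
      refine continuousAt_const.add (ContinuousAt.log (by fun_prop) ?_)
      positivity
    exact h1.tendsto.mono_left nhdsWithin_le_nhds

/-- The mean value property for `log ‖f‖` in a strip where `f` has no zeros. -/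
lemma logLineMean_add_eq_of_ne_zero {a c C : ℝ} {f : ℂ → ℂ} (ha : 0 < a)
    (hf : Differentiable ℂ f) (hC : 0 ≤ C)
    (hfC : ∀ s : ℂ, |s.re - c| ≤ π / (2 * a) → |log ‖f s‖| ≤ C * (1 + |s.im|))
    (hf0 : ∀ s : ℂ, |s.re - c| ≤ π / (2 * a) → f s ≠ 0) :
    Integrable (fun t => sechKernel a t * log ‖f ((c - π / (2 * a) : ℝ) + t * Complex.I)‖) ∧
    Integrable (fun t => sechKernel a t * log ‖f ((c + π / (2 * a) : ℝ) + t * Complex.I)‖) ∧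
    logLineMean a f (c - π / (2 * a)) + logLineMean a f (c + π / (2 * a)) = log ‖f c‖ := by
  have hw : 0 < π / (2 * a) := by positivity
  obtain ⟨h1, h2, h3⟩ := tendsto_circleAverage_logLineMean_add (r₀ := 0) ha hf hC (by simp)
    (fun w _ hw => hfC _ (abs_stripMap_re_sub_lt ha c hw).le)
    (fun t => hf0 _ (by
      have e : (((c - π / (2 * a) : ℝ) : ℂ) + t * Complex.I).re = c - π / (2 * a) := by
        rw [Complex.add_re, Complex.ofReal_re, Complex.re_ofReal_mul]; simp
      rw [e, abs_le]; constructor <;> linarith))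
    (fun t => hf0 _ (by
      have e : (((c + π / (2 * a) : ℝ) : ℂ) + t * Complex.I).re = c + π / (2 * a) := by
        rw [Complex.add_re, Complex.ofReal_re, Complex.re_ofReal_mul]; simp
      rw [e, abs_le]; constructor <;> linarith))
  refine ⟨h1, h2, tendsto_nhds_unique h3 ?_⟩
  refine tendsto_const_nhds.congr' ?_
  filter_upwards [Ioo_mem_nhdsLT (zero_lt_one (α := ℝ))] with r hr
  have hg := (analyticOnNhd_comp_stripMap hf a c).mono (closedBall_subset_unit_ball hr)
  have h := hg.circleAverage_log_norm_of_ne_zero (fun u hu => hf0 _ (abs_stripMap_re_sub_lt ha c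
    (by simpa using closedBall_subset_unit_ball hr hu)).le)
  simpa [stripMap_zero] using h.symm

lemma abs_log_le_of_le_of_le {x m M B : ℝ} (hm : 0 < m) (h1 : m ≤ x) (h2 : x ≤ M)
    (h3 : -log m ≤ B) (h4 : log M ≤ B) : |log x| ≤ B := by
  rw [abs_le]
  have := log_le_log hm h1
  have := log_le_log (hm.trans_le h1) h2
  constructor <;> linarith

/-- Jensen's formula in the strip for the linear factor `s - x` with a real zero `x` inside the
strip. In the coordinate `w` of the disc, `s - x` is `w - w₀` times a function without zeros. -/
lemma logLineMean_add_sub_const {a c x : ℝ} (ha : 0 < a) (hx : |x - c| < π / (2 * a))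
    (hxc : x ≠ c) :
    Integrable (fun t : ℝ => sechKernel a t *
      log ‖((c - π / (2 * a) : ℝ) + t * Complex.I) - (x : ℂ)‖) ∧
    Integrable (fun t : ℝ => sechKernel a t *
      log ‖((c + π / (2 * a) : ℝ) + t * Complex.I) - (x : ℂ)‖) ∧
    logLineMean a (fun s => s - x) (c - π / (2 * a)) +
      logLineMean a (fun s => s - x) (c + π / (2 * a)) =
        log ‖(c : ℂ) - x‖ - log ‖stripInv a c x‖ := by
  have hx' : |(x : ℂ).re - c| < π / (2 * a) := by simpa using hx
  set w₀ := stripInv a c x with hw₀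
  have hw₀1 : ‖w₀‖ < 1 := norm_stripInv_lt_one ha hx'
  have hw₀x : stripMap a c w₀ = x := stripMap_stripInv ha hx'
  have hw₀0 : w₀ ≠ 0 := fun h => by
    rw [h, stripMap_zero] at hw₀x
    exact hxc (by exact_mod_cast hw₀x.symm)
  have hw : 0 < π / (2 * a) := by positivity
  set f : ℂ → ℂ := fun s => s - x with hf
  have hfd : Differentiable ℂ f := by fun_prop
  -- in the disc, `s - x` is bounded away from zero on the annulus `r₀ < ‖w‖ < 1`
  obtain ⟨ε, hε, hεr⟩ : ∃ ε > 0, ∀ s : ℂ, ‖s - x‖ < ε → ‖stripInv a c s‖ < (1 + ‖w₀‖) / 2 := by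
    have h := (differentiableAt_stripInv ha hx').continuousAt.norm.eventually
      (gt_mem_nhds (show ‖w₀‖ < (1 + ‖w₀‖) / 2 by linarith))
    obtain ⟨ε, hε, h⟩ := Metric.eventually_nhds_iff.1 h
    exact ⟨ε, hε, fun s hs => h (by rwa [dist_eq_norm])⟩
  set r₀ := (1 + ‖w₀‖) / 2 with hr₀
  have hr₀m : r₀ ∈ Ico (0 : ℝ) 1 := ⟨by rw [hr₀]; positivity, by rw [hr₀]; linarith⟩
  set C : ℝ := max (-log ε) (1 + |c| + π / (2 * a) + |x|) with hC
  have hC1 : 1 + |c| + π / (2 * a) + |x| ≤ C := le_max_right _ _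
  have hC0 : 1 ≤ C := by
    have := abs_nonneg c; have := abs_nonneg x; linarith
  have hbd : ∀ w : ℂ, r₀ < ‖w‖ → ‖w‖ < 1 →
      |log ‖f (stripMap a c w)‖| ≤ C * (1 + |(stripMap a c w).im|) := by
    intro w hw1 hw2
    have hlow : ε ≤ ‖f (stripMap a c w)‖ := by
      by_contra! h
      have := hεr _ h
      rw [stripInv_stripMap ha hw2] at this
      linarith
    have hre := abs_stripMap_re_sub_lt ha c hw2
    set s := stripMap a c w
    have hup : ‖f s‖ ≤ |c| + π / (2 * a) + |x| + |s.im| := by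
      have h1 : ‖s - x‖ ≤ |s.re - x| + |s.im| := by
        have := Complex.norm_le_abs_re_add_abs_im (s - x)
        simpa using this
      have h2 : |s.re - x| ≤ |s.re - c| + |c| + |x| := by
        calc |s.re - x| = |(s.re - c) + c - x| := by ring_nf
          _ ≤ |(s.re - c) + c| + |x| := abs_sub _ _
          _ ≤ _ := by gcongr; exact abs_add_le _ _
      simp only [hf]; linarith
    have him := abs_nonneg s.im
    refine abs_log_le_of_le_of_le hε hlow le_rfl ?_ ?_
    · have : -log ε ≤ C := le_max_left _ _
      nlinarith
    · refine (log_le_self (norm_nonneg _)).trans (hup.trans ?_)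
      nlinarith
  have hne : ∀ β : ℝ, |β - c| = π / (2 * a) → ∀ t : ℝ, f (β + t * Complex.I) ≠ 0 := by
    intro β hβ t h
    have := congrArg Complex.re h
    simp only [hf, Complex.sub_re, Complex.add_re, Complex.ofReal_re, Complex.re_ofReal_mul,
      Complex.I_re, mul_zero, add_zero, Complex.zero_re, sub_eq_zero] at this
    rw [this] at hβ
    exact hx.ne hβ
  obtain ⟨h1, h2, h3⟩ := tendsto_circleAverage_logLineMean_add (f := f) (C := C) ha hfd
    (by linarith) hr₀m hbd (hne _ (by rw [sub_sub_cancel_left, abs_neg, abs_of_pos hw]))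
    (hne _ (by rw [add_sub_cancel_left, abs_of_pos hw]))
  refine ⟨h1, h2, tendsto_nhds_unique h3 ?_⟩
  have hlim : Tendsto (fun r => log r + (log ‖(c : ℂ) - x‖ - log ‖w₀‖)) (𝓝[<] 1)
      (𝓝 (log ‖(c : ℂ) - x‖ - log ‖w₀‖)) := by
    have h : ContinuousAt (fun r => log r + (log ‖(c : ℂ) - x‖ - log ‖w₀‖)) 1 :=
      (continuousAt_log one_ne_zero).add continuousAt_const
    have h' := h.tendsto.mono_left (nhdsWithin_le_nhds (s := Iio 1))
    simpa using h'
  refine hlim.congr' ?_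
  filter_upwards [Ioo_mem_nhdsLT hr₀m.2] with r hr
  have hrw : ‖w₀‖ < r := by
    refine lt_trans ?_ hr.1
    rw [hr₀]; linarith
  have hr' : r ∈ Ioo (0 : ℝ) 1 := ⟨hr₀m.1.trans_lt hr.1, hr.2⟩
  -- `s - x` is the product of `w - w₀` and a function without zeros
  set g : ℂ → ℂ := fun w => f (stripMap a c w) with hg
  set k : ℂ → ℂ := dslope g w₀ with hk
  have hga := analyticOnNhd_comp_stripMap hfd a c
  have hgw₀ : g w₀ = 0 := by simp [hg, hf, hw₀x]
  have hgk : ∀ w, g w = (w - w₀) * k w := fun w => by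
    have := sub_smul_dslope g w₀ w
    rw [hgw₀, sub_zero, smul_eq_mul] at this
    exact this.symm
  have hka : AnalyticOnNhd ℂ k (Metric.ball 0 1) := by
    refine DifferentiableOn.analyticOnNhd ?_ Metric.isOpen_ball
    exact (Complex.differentiableOn_dslope (Metric.isOpen_ball.mem_nhds (by simpa using hw₀1))).2
      hga.differentiableOn
  have hk0 : ∀ w ∈ Metric.ball (0 : ℂ) 1, k w ≠ 0 := fun w hw hkw => by
    have hw' : ‖w‖ < 1 := by simpa using hw
    rcases eq_or_ne w w₀ with rfl | hne
    · rw [hk, dslope_same] at hkw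
      have hd1 : HasDerivAt (stripInv a c ∘ stripMap a c) 1 w₀ := by
        refine (hasDerivAt_id w₀).congr_of_eventuallyEq ?_
        filter_upwards [Metric.isOpen_ball.mem_nhds hw] with v hv
        simp only [Function.comp, id]
        exact stripInv_stripMap ha (by simpa using hv)
      have hd2 : HasDerivAt (stripMap a c) 0 w₀ := by
        have hd := (differentiableAt_stripMap a c hw').hasDerivAt
        have : deriv g w₀ = deriv (stripMap a c) w₀ := by
          simp only [hg, hf]; rw [deriv_sub_const_fun]
        rwa [← this, hkw] at hd
      have hd3 : DifferentiableAt ℂ (stripInv a c) (stripMap a c w₀) := by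
        rw [hw₀x]
        exact differentiableAt_stripInv ha hx'
      have hd4 := hd3.hasDerivAt.comp w₀ hd2
      have := hd1.unique hd4
      simp at this
    · have h0 : g w = 0 := by rw [hgk, hkw, mul_zero]
      have h1 : stripMap a c w = x := by simpa [hg, hf, sub_eq_zero] using h0
      apply hne
      rw [← stripInv_stripMap (c := c) ha hw', h1]
  have hsub := closedBall_subset_unit_ball hr'
  have e1 : circleAverage (fun w => log ‖k w‖) 0 r = log ‖k 0‖ :=
    (hka.mono hsub).circleAverage_log_norm_of_ne_zero (fun u hu => hk0 u (hsub hu))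
  have e2 : circleAverage (fun w => log ‖w - w₀‖) 0 r = log r := by
    rw [circleAverage_log_norm_sub_const_eq_log_radius_add_posLog hr'.1.ne', zero_sub, norm_neg,
      add_eq_left, posLog_eq_zero_iff, abs_of_nonneg (by have := hr'.1; positivity),
      inv_mul_le_one₀ hr'.1]
    exact hrw.le
  have e3 : circleAverage (fun w => log ‖f (stripMap a c w)‖) 0 r =
      circleAverage (fun w => log ‖w - w₀‖) 0 r + circleAverage (fun w => log ‖k w‖) 0 r := by
    rw [← circleAverage_fun_add (circleIntegrable_log_norm_sub_const r)
      (MeromorphicOn.circleIntegrable_log_norm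
        ((hka.mono (Metric.sphere_subset_closedBall.trans hsub)).meromorphicOn))]
    refine circleAverage_congr_sphere fun w hw => ?_
    have hwr : ‖w‖ = r := by simpa [abs_of_pos hr'.1] using hw
    change log ‖g w‖ = _
    rw [hgk, norm_mul, log_mul]
    · rw [norm_ne_zero_iff, sub_ne_zero]
      rintro rfl; linarith
    · exact norm_ne_zero_iff.2 (hk0 w (by simpa [hwr] using hr'.2))
  have e4 : log ‖k 0‖ = log ‖(c : ℂ) - x‖ - log ‖w₀‖ := by
    have h0 := hgk 0
    have hk00 : k 0 ≠ 0 := hk0 0 (by simp)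
    simp only [hg, hf, stripMap_zero, zero_sub] at h0
    rw [h0, norm_mul, norm_neg, log_mul (norm_ne_zero_iff.2 hw₀0) (norm_ne_zero_iff.2 hk00)]
    ring
  rw [e3, e2, e1, e4]

/-! ### Bounds for the zeta function -/

/-- The fractional part on `(1, ∞)`, extended by zero. -/
noncomputable def fractTail : ℝ → ℂ := (Ioi (1 : ℝ)).indicator fun t => ((Int.fract t : ℝ) : ℂ)

lemma measurable_fractTail : Measurable fractTail :=
  (Complex.measurable_ofReal.comp measurable_fract).indicator measurableSet_Ioi

lemma norm_fractTail_le (t : ℝ) : ‖fractTail t‖ ≤ 1 := by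
  unfold fractTail
  by_cases h : t ∈ Ioi (1 : ℝ)
  · rw [indicator_of_mem h, Complex.norm_real, norm_of_nonneg (Int.fract_nonneg t)]
    exact (Int.fract_lt_one t).le
  · rw [indicator_of_notMem h]; simp

lemma mellin_fractTail (s : ℂ) :
    mellin fractTail (-s) = ∫ t in Ioi (1 : ℝ), (t : ℂ) ^ (-s - 1) * ((Int.fract t : ℝ) : ℂ) := by
  unfold mellin fractTail
  have : (fun t : ℝ => (t : ℂ) ^ (-s - 1) •
      (Ioi (1 : ℝ)).indicator (fun t => ((Int.fract t : ℝ) : ℂ)) t) =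
      (Ioi (1 : ℝ)).indicator (fun t => (t : ℂ) ^ (-s - 1) * ((Int.fract t : ℝ) : ℂ)) := by
    ext t
    by_cases h : t ∈ Ioi (1 : ℝ) <;> simp [h]
  rw [this, setIntegral_indicator measurableSet_Ioi, inter_eq_right.2]
  exact Ioi_subset_Ioi zero_le_one

lemma differentiableAt_mellin_fractTail {s : ℂ} (hs : 0 < s.re) :
    DifferentiableAt ℂ (fun s => mellin fractTail (-s)) s := by
  have h := mellin_differentiableAt_of_isBigO_rpow (f := fractTail) (s := -s) (a := 0)
    (b := -s.re - 1) ?_ ?_ (by simpa using hs) ?_ (by simp)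
  · exact h.comp s differentiableAt_id.neg
  · refine (LocallyIntegrable.mono (locallyIntegrable_const (1 : ℝ))
      measurable_fractTail.aestronglyMeasurable ?_).locallyIntegrableOn _
    exact Eventually.of_forall fun t => by simpa using norm_fractTail_le t
  · refine Asymptotics.IsBigO.of_bound 1 (Eventually.of_forall fun t => ?_)
    simpa using norm_fractTail_le t
  · refine Asymptotics.IsBigO.of_bound 1 ?_
    have : Iio (1 : ℝ) ∈ 𝓝[>] (0 : ℝ) := mem_nhdsWithin_of_mem_nhds (Iio_mem_nhds one_pos)
    filter_upwards [this] with t ht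
    have : fractTail t = 0 := indicator_of_notMem (by simpa using le_of_lt ht) _
    rw [this, norm_zero]; positivity

lemma norm_mellin_fractTail_le {s : ℂ} (hs : 0 < s.re) :
    ‖mellin fractTail (-s)‖ ≤ 1 / s.re := by
  rw [mellin_fractTail]
  have h1 : ∫ t in Ioi (1 : ℝ), t ^ (-s.re - 1) = 1 / s.re := by
    rw [integral_Ioi_rpow_of_lt (by linarith) one_pos]
    simp
  rw [← h1]
  refine norm_integral_le_of_norm_le (integrableOn_Ioi_rpow_of_lt (by linarith) one_pos) ?_
  refine (ae_restrict_iff' measurableSet_Ioi).2 (Eventually.of_forall fun t ht => ?_)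
  have ht0 : (0 : ℝ) < t := one_pos.trans ht
  rw [norm_mul, Complex.norm_cpow_eq_rpow_re_of_pos ht0, Complex.norm_real,
    norm_of_nonneg (Int.fract_nonneg t)]
  simp only [Complex.sub_re, Complex.neg_re, Complex.one_re]
  exact mul_le_of_le_one_right (rpow_nonneg ht0.le _) (Int.fract_lt_one t).le

lemma riemannZeta₁_eq_mul {s : ℂ} (hs : s ≠ 1) : riemannZeta₁ s = (s - 1) * riemannZeta s := by
  rw [riemannZeta_eq_inv_sub_mul hs, mul_inv_cancel_left₀ (sub_ne_zero.2 hs)]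

lemma riemannZeta₁_eq_of_one_lt_re {s : ℂ} (hs : 1 < s.re) :
    riemannZeta₁ s = s - s * (s - 1) * mellin fractTail (-s) := by
  have hs1 : s ≠ 1 := by rintro rfl; simp at hs
  have h := LSeries_eq_mul_integral_of_nonneg (fun _ => 1) (r := 1) zero_le_one hs
    (by simpa using Asymptotics.isBigO_refl _ _) (by simp)
  have e0 : LSeries (fun _ : ℕ => (((1 : ℝ)) : ℂ)) s = riemannZeta s := by
    rw [← LSeries_one_eq_riemannZeta hs]; simp; rfl
  rw [e0] at h
  have hI1 : IntegrableOn (fun t : ℝ => (t : ℂ) ^ (-s)) (Ioi 1) :=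
    integrableOn_Ioi_cpow_of_lt (by simpa using hs) one_pos
  have hI2 : IntegrableOn (fun t : ℝ => (t : ℂ) ^ (-s - 1) * ((Int.fract t : ℝ) : ℂ)) (Ioi 1) := by
    have := integrableOn_Ioi_cpow_of_lt (a := -s - 1) (by simp; linarith) one_pos
    refine this.mul_bdd (c := 1)
      (Complex.measurable_ofReal.comp measurable_fract).aestronglyMeasurable
      (Eventually.of_forall fun t => ?_)
    rw [Complex.norm_real, norm_of_nonneg (Int.fract_nonneg t)]
    exact (Int.fract_lt_one t).le
  have e1 : ∫ t in Ioi (1 : ℝ), (∑ k ∈ Finset.Icc 1 ⌊t⌋₊, (((1 : ℝ)) : ℂ)) * (t : ℂ) ^ (-(s + 1)) =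
      ∫ t in Ioi (1 : ℝ), ((t : ℂ) ^ (-s) - (t : ℂ) ^ (-s - 1) * ((Int.fract t : ℝ) : ℂ)) := by
    refine setIntegral_congr_fun measurableSet_Ioi fun t ht => ?_
    have ht0 : (0 : ℝ) < t := one_pos.trans ht
    have ht0' : (t : ℂ) ≠ 0 := by exact_mod_cast ht0.ne'
    have e2 : (t : ℂ) ^ (-s) = (t : ℂ) ^ (-s - 1) * t := by
      rw [Complex.cpow_sub _ _ ht0', Complex.cpow_one, div_mul_cancel₀ _ ht0']
    have e3 : ((⌊t⌋₊ : ℕ) : ℂ) = t - ((Int.fract t : ℝ) : ℂ) := by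
      have : ((⌊t⌋₊ : ℕ) : ℝ) = t - Int.fract t := by
        rw [natCast_floor_eq_intCast_floor ht0.le, Int.self_sub_fract]
      rw [← Complex.ofReal_sub, ← this]; simp
    simp only [Complex.ofReal_one, Finset.sum_const, Nat.card_Icc, add_tsub_cancel_right,
      nsmul_eq_mul, mul_one]
    rw [e2, e3, show -(s + 1) = -s - 1 by ring]
    ring
  rw [e1, integral_sub hI1 hI2, ← mellin_fractTail, integral_Ioi_cpow_of_lt (by simpa using hs)
    one_pos] at h
  rw [riemannZeta₁_eq_mul hs1, h]
  have h2 : -s + 1 ≠ 0 := fun h => hs1 (by linear_combination -h)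
  simp only [Complex.ofReal_one, Complex.one_cpow]
  field_simp
  ring

/-- The integral representation which continues the zeta function to `Re s > 0`. -/
lemma riemannZeta₁_eq_of_re_pos {s : ℂ} (hs : 0 < s.re) :
    riemannZeta₁ s = s - s * (s - 1) * mellin fractTail (-s) := by
  have ho : IsOpen {s : ℂ | 0 < s.re} := isOpen_lt continuous_const Complex.continuous_re
  have hpre : IsPreconnected {s : ℂ | 0 < s.re} := (convex_halfSpace_re_gt 0).isPreconnected
  have h1 : AnalyticOnNhd ℂ riemannZeta₁ {s : ℂ | 0 < s.re} :=
    differentiable_riemannZeta₁.differentiableOn.analyticOnNhd ho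
  have h2 : AnalyticOnNhd ℂ (fun s => s - s * (s - 1) * mellin fractTail (-s))
      {s : ℂ | 0 < s.re} := by
    refine DifferentiableOn.analyticOnNhd (fun s hs => ?_) ho
    have := differentiableAt_mellin_fractTail hs
    exact (differentiableAt_id.sub ((differentiableAt_id.mul
      (differentiableAt_id.sub_const 1)).mul this)).differentiableWithinAt
  refine h1.eqOn_of_preconnected_of_eventuallyEq h2 hpre (z₀ := 2) (by simp) ?_ hs
  have : {s : ℂ | 1 < s.re} ∈ 𝓝 (2 : ℂ) :=
    (isOpen_lt continuous_const Complex.continuous_re).mem_nhds (by simp)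
  filter_upwards [this] with z hz using riemannZeta₁_eq_of_one_lt_re hz

/-- A polynomial bound for `(s - 1) ζ(s)`, in logarithmic form. -/
lemma log_norm_riemannZeta₁_le {s : ℂ} (hs : 1 / 2 ≤ s.re) :
    log ‖riemannZeta₁ s‖ ≤ 2 * (1 + ‖s‖) := by
  have hs0 : 0 < s.re := by linarith
  have h1 := norm_mellin_fractTail_le hs0
  have h2 : 1 / s.re ≤ 2 := by rw [div_le_iff₀ hs0]; linarith
  have h3 : ‖riemannZeta₁ s‖ ≤ 2 * (1 + ‖s‖) ^ 2 := by
    rw [riemannZeta₁_eq_of_re_pos hs0]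
    have h4 : ‖s - 1‖ ≤ ‖s‖ + 1 := (norm_sub_le _ _).trans (by simp)
    calc ‖s - s * (s - 1) * mellin fractTail (-s)‖
        ≤ ‖s‖ + ‖s * (s - 1) * mellin fractTail (-s)‖ := norm_sub_le _ _
      _ = ‖s‖ + ‖s‖ * ‖s - 1‖ * ‖mellin fractTail (-s)‖ := by rw [norm_mul, norm_mul]
      _ ≤ ‖s‖ + ‖s‖ * (‖s‖ + 1) * 2 := by gcongr; exact h1.trans h2
      _ ≤ 2 * (1 + ‖s‖) ^ 2 := by nlinarith [norm_nonneg s]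
  rcases (norm_nonneg (riemannZeta₁ s)).eq_or_lt with h0 | h0
  · rw [← h0, log_zero]; positivity
  have h5 : 0 < 1 + ‖s‖ := by positivity
  calc log ‖riemannZeta₁ s‖ ≤ log (2 * (1 + ‖s‖) ^ 2) := log_le_log h0 h3
    _ = log 2 + 2 * log (1 + ‖s‖) := by
        rw [log_mul two_ne_zero (by positivity), log_pow]; push_cast; ring
    _ ≤ 1 + 2 * ‖s‖ := by
        have := log_le_sub_one_of_pos (zero_lt_two (α := ℝ))
        have := log_le_sub_one_of_pos h5
        linarith
    _ ≤ _ := by linarith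

/-- In `Re s ≥ σ > 1`, `log |ζ|` is bounded, as `ζ` and `1 / ζ` have absolutely convergent Dirichlet
series. -/
lemma exists_abs_log_norm_riemannZeta_le {σ : ℝ} (hσ : 1 < σ) :
    ∃ B : ℝ, 0 ≤ B ∧ ∀ s : ℂ, σ ≤ s.re → |log ‖riemannZeta s‖| ≤ B := by
  have hσ' : 1 < (σ : ℂ).re := by simpa using hσ
  have hS : Summable fun n => ‖LSeries.term 1 (σ : ℂ) n‖ := (LSeriesSummable_one_iff.2 hσ').norm
  set Z := ∑' n, ‖LSeries.term 1 (σ : ℂ) n‖ with hZ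
  have hb : ∀ (f : ℕ → ℂ), (∀ n, ‖f n‖ ≤ 1) → ∀ s : ℂ, σ ≤ s.re → ‖LSeries f s‖ ≤ Z := by
    intro f hf s hs
    refine tsum_of_norm_bounded hS.hasSum fun n => ?_
    refine (LSeries.norm_term_le s (f := f) (g := 1) (by simpa using hf n)).trans ?_
    exact LSeries.norm_term_le_of_re_le_re 1 (by simpa using hs) n
  have hZ1 : 1 ≤ Z := by
    have h := hS.le_tsum 1 (fun n _ => norm_nonneg _)
    have e : ‖LSeries.term 1 (σ : ℂ) 1‖ = 1 := by simp [LSeries.term]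
    rwa [e] at h
  refine ⟨log Z, log_nonneg hZ1, fun s hs => ?_⟩
  have hs1 : 1 < s.re := hσ.trans_le hs
  have h1 : ‖riemannZeta s‖ ≤ Z := by
    rw [← LSeries_one_eq_riemannZeta hs1]
    exact hb 1 (by simp) s hs
  have h2 : ‖LSeries (fun n => ((ArithmeticFunction.moebius n : ℤ) : ℂ)) s‖ ≤ Z := by
    refine hb _ (fun n => ?_) s hs
    rw [Complex.norm_intCast]
    exact_mod_cast ArithmeticFunction.abs_moebius_le_one
  have h3 : riemannZeta s * LSeries (fun n => ((ArithmeticFunction.moebius n : ℤ) : ℂ)) s = 1 := by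
    have := ArithmeticFunction.LSeries_zeta_mul_Lseries_moebius hs1
    rwa [ArithmeticFunction.LSeries_zeta_eq_riemannZeta hs1] at this
  have h4 : 1 ≤ ‖riemannZeta s‖ * Z := by
    calc (1 : ℝ) = ‖riemannZeta s‖ *
          ‖LSeries (fun n => ((ArithmeticFunction.moebius n : ℤ) : ℂ)) s‖ := by
          rw [← norm_mul, h3, norm_one]
      _ ≤ _ := by gcongr
  have hZ0 : 0 < Z := one_pos.trans_le hZ1
  refine abs_log_le_of_le_of_le (inv_pos.2 hZ0) (by rwa [inv_le_iff_one_le_mul₀ hZ0]) h1 ?_ le_rfl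
  rw [log_inv, neg_neg]

/-- `ζ(s)` tends to `1` exponentially fast as `Re s → ∞`. -/
lemma exists_norm_riemannZeta_sub_one_le :
    ∃ A : ℝ, 0 ≤ A ∧ ∀ s : ℂ, 2 ≤ s.re → ‖riemannZeta s - 1‖ ≤ A * 2 ^ (-s.re) := by
  have hS : Summable fun n : ℕ => ((n : ℝ) + 2) ^ (-2 : ℝ) := by
    have := (summable_nat_add_iff 2).2 (Real.summable_nat_rpow.2 (by norm_num : (-2 : ℝ) < -1))
    simpa using this
  refine ⟨4 * ∑' n : ℕ, ((n : ℝ) + 2) ^ (-2 : ℝ),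
    mul_nonneg (by norm_num) (tsum_nonneg fun n => by positivity), fun s hs => ?_⟩
  have hs1 : 1 < s.re := by linarith
  have hsum : Summable fun n : ℕ => 1 / ((n : ℂ) + 1) ^ s := by
    have := (summable_nat_add_iff 1).2 (Complex.summable_one_div_nat_cpow.2 hs1)
    simpa using this
  have e : riemannZeta s - 1 = ∑' n : ℕ, 1 / ((n : ℂ) + 2) ^ s := by
    rw [zeta_eq_tsum_one_div_nat_add_one_cpow hs1, hsum.tsum_eq_zero_add]
    simp only [Nat.cast_zero, zero_add, Complex.one_cpow, div_one, add_sub_cancel_left]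
    congr 1; ext n; push_cast; ring_nf
  rw [e, mul_right_comm]
  have hS' := hS.hasSum.mul_left (4 * (2 : ℝ) ^ (-s.re))
  refine tsum_of_norm_bounded hS' fun n => ?_
  have hn : (0 : ℝ) < (n : ℝ) + 2 := by positivity
  have e1 : ‖1 / ((n : ℂ) + 2) ^ s‖ = ((n : ℝ) + 2) ^ (-s.re) := by
    have : ((n : ℂ) + 2) = (((n : ℝ) + 2 : ℝ) : ℂ) := by push_cast; ring
    rw [norm_div, norm_one, this, Complex.norm_cpow_eq_rpow_re_of_pos hn, rpow_neg hn.le, one_div]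
  have e2 : ((n : ℝ) + 2) ^ (-s.re) = ((n : ℝ) + 2) ^ (2 - s.re) * ((n : ℝ) + 2) ^ (-2 : ℝ) := by
    rw [← rpow_add hn]; ring_nf
  have e3 : 4 * (2 : ℝ) ^ (-s.re) = 2 ^ (2 - s.re) := by
    rw [sub_eq_add_neg, rpow_add two_pos]; norm_num
  rw [e1, e2, e3]
  refine mul_le_mul_of_nonneg_right (rpow_le_rpow_of_nonpos two_pos ?_ (by linarith))
    (by positivity)
  have := n.cast_nonneg (α := ℝ)
  linarith

/-- For real `x > 1` the value `ζ(x)` is a positive real number, so its principal logarithm is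
real. -/
lemma log_riemannZeta_ofReal {x : ℝ} (hx : 1 < x) :
    Complex.log (riemannZeta x) = ((log ‖riemannZeta x‖ : ℝ) : ℂ) := by
  have h := riemannZeta_pos_of_one_lt hx
  obtain ⟨y, hy, e⟩ : ∃ y : ℝ, 0 < y ∧ riemannZeta x = y := by
    rw [Complex.lt_def] at h
    refine ⟨(riemannZeta x).re, by simpa using h.1, Complex.ext (by simp) (by simpa using h.2.symm)⟩
  rw [e, Complex.norm_real, norm_of_nonneg hy.le, Complex.ofReal_log hy.le]

/-- By the functional equation, the Riemann hypothesis says that there are no zeros to the right of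
the critical line. -/
lemma riemannHypothesis_iff :
    RiemannHypothesis ↔ ∀ s : ℂ, s ≠ 1 → 1 / 2 < s.re → riemannZeta s ≠ 0 := by
  constructor
  · intro h s hs1 hs h0
    have := h s h0 (by
      rintro ⟨n, rfl⟩
      have : ((-2 * ((n : ℂ) + 1))).re = -2 * (n + 1) := by simp
      rw [this] at hs
      have := n.cast_nonneg (α := ℝ)
      linarith) hs1
    linarith
  · intro h s h0 htriv hs1
    have hle : s.re ≤ 1 / 2 := not_lt.1 fun hlt => h s hs1 hlt h0
    have hs0 : s ≠ 0 := by
      rintro rfl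
      rw [riemannZeta_zero] at h0; norm_num at h0
    refine le_antisymm hle (not_lt.1 fun hlt => ?_)
    rw [riemannZeta_def_of_ne_zero hs0, div_eq_zero_iff] at h0
    rcases h0 with h0 | h0
    · have h1 : (1 : ℂ) - s ≠ 0 := sub_ne_zero.2 hs1.symm
      refine h (1 - s) (by simpa using hs0) (by simp; linarith) ?_
      rw [riemannZeta_def_of_ne_zero h1, completedRiemannZeta_one_sub, h0, zero_div]
    · rw [Complex.Gammaℝ_eq_zero_iff] at h0
      obtain ⟨n, hn⟩ := h0
      rcases n with _ | n
      · apply hs0; simpa using hn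
      · exact htriv ⟨n, by rw [hn]; push_cast; ring⟩

/-! ### Lower bounds in zero-free half-planes -/

/-- A holomorphic logarithm of a function without zeros in a disc. -/
lemma exists_holomorphic_log {f : ℂ → ℂ} {R : ℝ} (hR : 0 < R)
    (hf : DifferentiableOn ℂ f (Metric.ball 0 R)) (hf0 : ∀ z ∈ Metric.ball (0 : ℂ) R, f z ≠ 0) :
    ∃ g : ℂ → ℂ, DifferentiableOn ℂ g (Metric.ball 0 R) ∧ g 0 = Complex.log (f 0) ∧
      ∀ z ∈ Metric.ball (0 : ℂ) R, Complex.exp (g z) = f z := by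
  have hl : DifferentiableOn ℂ (fun z => deriv f z / f z) (Metric.ball 0 R) :=
    (hf.deriv Metric.isOpen_ball).div hf hf0
  obtain ⟨g, hg0, hg⟩ := (hl.isExactOn_ball).with_val_at 0 (Complex.log (f 0))
  refine ⟨g, fun z hz => (hg z hz).differentiableAt.differentiableWithinAt, hg0, fun z hz => ?_⟩
  have h0 : (0 : ℂ) ∈ Metric.ball (0 : ℂ) R := Metric.mem_ball_self hR
  have hder : ∀ z ∈ Metric.ball (0 : ℂ) R,
      HasDerivAt (fun z => f z * Complex.exp (-g z)) 0 z := fun z hz => by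
    have h1 : HasDerivAt f (deriv f z) z :=
      (hf.differentiableAt (Metric.isOpen_ball.mem_nhds hz)).hasDerivAt
    refine (h1.mul (hg z hz).neg.cexp).congr_deriv ?_
    have := hf0 z hz
    field_simp
    ring
  have hconst := Metric.isOpen_ball.is_const_of_deriv_eq_zero
    (convex_ball (0 : ℂ) R).isPreconnected
    (fun z hz => (hder z hz).differentiableAt.differentiableWithinAt)
    (fun z hz => (hder z hz).deriv) hz h0
  simp only [hg0] at hconst
  rw [Complex.exp_neg, Complex.exp_neg, Complex.exp_log (hf0 0 h0), mul_inv_cancel₀ (hf0 0 h0),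
    mul_inv_eq_one₀ (Complex.exp_ne_zero _)] at hconst
  exact hconst.symm

/-- The Borel-Carathéodory theorem applied to a logarithm: an upper bound for `log ‖f‖` in a disc
without zeros gives a lower bound in smaller discs. -/
lemma abs_log_norm_le_of_ne_zero {f : ℂ → ℂ} {R M : ℝ} (hR : 0 < R) (hM : 0 < M)
    (hf : DifferentiableOn ℂ f (Metric.ball 0 R)) (hf0 : ∀ z ∈ Metric.ball (0 : ℂ) R, f z ≠ 0)
    (hfM : ∀ z ∈ Metric.ball (0 : ℂ) R, log ‖f z‖ ≤ M) {z : ℂ} (hz : z ∈ Metric.ball (0 : ℂ) R) :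
    |log ‖f z‖| ≤ (2 * M + 2 * (|log ‖f 0‖| + π)) * R / (R - ‖z‖) := by
  obtain ⟨g, hg, hg0, hgf⟩ := exists_holomorphic_log hR hf hf0
  have hre : ∀ z ∈ Metric.ball (0 : ℂ) R, (g z).re = log ‖f z‖ := fun z hz => by
    rw [← hgf z hz, Complex.norm_exp, log_exp]
  have hBC := Complex.borelCaratheodory hM hg (fun z hz => by
    change (g z).re ≤ M
    rw [hre z hz]; exact hfM z hz) hR hz
  have hz' : ‖z‖ < R := by simpa using hz
  have hd : 0 < R - ‖z‖ := by linarith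
  have hn0 : ‖g 0‖ ≤ |log ‖f 0‖| + π := by
    rw [hg0]
    refine (Complex.norm_le_abs_re_add_abs_im _).trans ?_
    rw [Complex.log_re, Complex.log_im]
    gcongr
    exact Complex.abs_arg_le_pi _
  rw [← hre z hz]
  refine (Complex.abs_re_le_norm _).trans (hBC.trans ?_)
  rw [← add_div]
  gcongr
  have h1 := norm_nonneg z
  have h2 := norm_nonneg (g 0)
  have h3 : 2 * M * ‖z‖ ≤ 2 * M * R := by gcongr
  have h4 : ‖g 0‖ * (R + ‖z‖) ≤ (|log ‖f 0‖| + π) * (2 * R) := by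
    gcongr; linarith
  linarith

lemma abs_log_norm_riemannZeta₁_le_of_bound {s : ℂ} {B : ℝ} (hs : 2 ≤ s.re)
    (hB : |log ‖riemannZeta s‖| ≤ B) : |log ‖riemannZeta₁ s‖| ≤ B + (1 + ‖s‖) := by
  have hs1 : s ≠ 1 := by rintro rfl; norm_num at hs
  have h0 : riemannZeta s ≠ 0 := riemannZeta_ne_zero_of_one_le_re (by linarith)
  have h1 : 1 ≤ ‖s - 1‖ := by
    have := Complex.abs_re_le_norm (s - 1)
    rw [Complex.sub_re, Complex.one_re] at this
    have := le_abs_self (s.re - 1)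
    linarith
  have h2 : ‖s - 1‖ ≤ 1 + ‖s‖ := (norm_sub_le _ _).trans (by rw [norm_one]; linarith)
  rw [riemannZeta₁_eq_mul hs1, norm_mul, log_mul (by linarith) (norm_ne_zero_iff.2 h0)]
  have h3 := log_nonneg h1
  have h4 := log_le_self (zero_le_one.trans h1)
  calc _ ≤ |log ‖s - 1‖| + |log ‖riemannZeta s‖| := abs_add_le _ _
    _ ≤ _ := by rw [abs_of_nonneg h3]; linarith

/-- If `(s - 1) ζ(s)` has no zeros in `Re s > b`, then `|log |(s - 1) ζ(s)||` grows at most linearly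
in `Re s ≥ β`, for each `β > b`. The discs for the Borel-Carathéodory theorem have their centres on
the line `Re s = 2` and touch the line `Re s = b`. -/
lemma exists_abs_log_norm_riemannZeta₁_le {b β : ℝ} (hb : 1 / 2 ≤ b) (hβ : b < β)
    (hb1 : b < 2) (hz : ∀ s : ℂ, b < s.re → riemannZeta₁ s ≠ 0) :
    ∃ C : ℝ, 0 ≤ C ∧ ∀ s : ℂ, β ≤ s.re → |log ‖riemannZeta₁ s‖| ≤ C * (1 + ‖s‖) := by
  obtain ⟨B, hB0, hB⟩ := exists_abs_log_norm_riemannZeta_le one_lt_two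
  set R := 2 - b with hR
  have hR0 : 0 < R := by linarith
  have hd : 0 < β - b := by linarith
  have hπ := pi_pos
  set C := max (B + 1) ((2 * 10 + 2 * (B + 4 + π)) * R / (β - b)) with hC
  have hC0 : B + 1 ≤ C := le_max_left _ _
  refine ⟨C, by linarith, fun s hs => ?_⟩
  have hn := norm_nonneg s
  rcases le_or_gt 2 s.re with h2 | h2
  · refine (abs_log_norm_riemannZeta₁_le_of_bound h2 (hB s h2)).trans ?_
    nlinarith
  set c₀ : ℂ := 2 + s.im * Complex.I with hc₀
  have hc₀re : c₀.re = 2 := by simp [hc₀]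
  have hsc : s - c₀ = ((s.re - 2 : ℝ) : ℂ) := by
    apply Complex.ext <;> simp [hc₀]
  have hscn : ‖s - c₀‖ = 2 - s.re := by
    rw [hsc, Complex.norm_real, Real.norm_eq_abs, abs_of_neg (by linarith)]; ring
  have hre : ∀ z ∈ Metric.ball (0 : ℂ) R, b < (z + c₀).re := fun z hz => by
    have h1 : ‖z‖ < R := by simpa using hz
    have h2 := (abs_le.1 (Complex.abs_re_le_norm z)).1
    rw [Complex.add_re, hc₀re]; linarith
  have hc₀n : ‖c₀‖ ≤ ‖s‖ + 2 := by
    calc ‖c₀‖ = ‖s - (s - c₀)‖ := by ring_nf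
      _ ≤ ‖s‖ + ‖s - c₀‖ := norm_sub_le _ _
      _ ≤ _ := by rw [hscn]; linarith
  have hmem : s - c₀ ∈ Metric.ball (0 : ℂ) R := by
    rw [mem_ball_zero_iff, hscn]; linarith
  have key := abs_log_norm_le_of_ne_zero (f := fun z => riemannZeta₁ (z + c₀)) (M := 10 * (1 + ‖s‖))
    hR0 (by positivity)
    ((differentiable_riemannZeta₁.comp (by fun_prop)).differentiableOn)
    (fun z hz' => hz _ (hre z hz')) (fun z hz' => by
      refine (log_norm_riemannZeta₁_le (hb.trans (hre z hz').le)).trans ?_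
      have h1 : ‖z‖ < R := by simpa using hz'
      have h2 : ‖z + c₀‖ ≤ ‖z‖ + ‖c₀‖ := norm_add_le _ _
      linarith) hmem
  simp only [sub_add_cancel, zero_add] at key
  have hc1 : |log ‖riemannZeta₁ c₀‖| ≤ (B + 3) + ‖s‖ := by
    refine (abs_log_norm_riemannZeta₁_le_of_bound hc₀re.ge (hB c₀ hc₀re.ge)).trans ?_
    linarith
  have hden : β - b ≤ R - ‖s - c₀‖ := by rw [hscn]; linarith
  calc _ ≤ _ := key
    _ ≤ ((2 * 10 + 2 * (B + 4 + π)) * (1 + ‖s‖)) * R / (β - b) := by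
        gcongr
        nlinarith
    _ = ((2 * 10 + 2 * (B + 4 + π)) * R / (β - b)) * (1 + ‖s‖) := by ring
    _ ≤ C * (1 + ‖s‖) := by gcongr; exact le_max_right _ _

/-! ### Zeros on the boundary line -/

lemma intervalIntegrable_abs_log_abs_sub (γ x y : ℝ) :
    IntervalIntegrable (fun t => |(log |t - γ|)|) volume x y := by
  have h : IntervalIntegrable (fun t : ℝ => log t) volume (x - γ) (y - γ) :=
    intervalIntegral.intervalIntegrable_log'
  have h2 := (h.comp_sub_right γ).abs
  simpa using h2

/-- Near a compact piece of a vertical line, the zeros of a holomorphic function only produce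
integrable logarithmic singularities. The majorant is uniform with respect to small shifts of the
line to the right. -/
lemma exists_intervalIntegrable_majorant {f : ℂ → ℂ} (hf : Differentiable ℂ f) {z₁ : ℂ}
    (hz₁ : f z₁ ≠ 0) (b : ℝ) {K : Set ℝ} (hK : IsCompact K) :
    {t ∈ K | f (b + t * Complex.I) = 0}.Finite ∧
    ∃ g : ℝ → ℝ, (∀ t, 0 ≤ g t) ∧ (∀ x y, IntervalIntegrable g volume x y) ∧
      ∀ᶠ δ in 𝓝[>] (0 : ℝ), ∀ t ∈ K, f (b + t * Complex.I) ≠ 0 →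
        -log ‖f ((b + δ : ℝ) + t * Complex.I)‖ ≤ g t := by
  refine hK.induction_on (p := fun K => {t ∈ K | f (b + t * Complex.I) = 0}.Finite ∧
    ∃ g : ℝ → ℝ, (∀ t, 0 ≤ g t) ∧ (∀ x y, IntervalIntegrable g volume x y) ∧
      ∀ᶠ δ in 𝓝[>] (0 : ℝ), ∀ t ∈ K, f (b + t * Complex.I) ≠ 0 →
        -log ‖f ((b + δ : ℝ) + t * Complex.I)‖ ≤ g t) ?_ ?_ ?_ ?_
  · exact ⟨by simp, fun _ => 0, by simp, by simp, by simp⟩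
  · rintro s t hst ⟨h1, g, hg0, hg, h2⟩
    exact ⟨h1.subset fun x hx => ⟨hst hx.1, hx.2⟩, g, hg0, hg,
      h2.mono fun δ hδ x hx => hδ x (hst hx)⟩
  · rintro s t ⟨h1, g, hg0, hg, h2⟩ ⟨h1', g', hg0', hg', h2'⟩
    refine ⟨(h1.union h1').subset ?_, fun x => g x + g' x, fun x => add_nonneg (hg0 x) (hg0' x),
      fun x y => (hg x y).add (hg' x y), ?_⟩
    · rintro x ⟨hx | hx, hx'⟩
      · exact Or.inl ⟨hx, hx'⟩
      · exact Or.inr ⟨hx, hx'⟩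
    · filter_upwards [h2, h2'] with δ h2 h2' x hx hx'
      have := hg0 x
      have := hg0' x
      rcases hx with hx | hx
      · have := h2 x hx hx'; linarith
      · have := h2' x hx hx'; linarith
  · intro γ _
    set ρ : ℂ := b + γ * Complex.I with hρ
    have han : AnalyticOnNhd ℂ f univ := hf.differentiableOn.analyticOnNhd isOpen_univ
    have hnz : ¬ ∀ᶠ z in 𝓝 ρ, f z = 0 := fun h => hz₁
      (han.eqOn_zero_of_preconnected_of_eventuallyEq_zero isPreconnected_univ (mem_univ ρ) h
        (mem_univ z₁))
    obtain ⟨n, g₀, hg₀, hg₀ρ, hfg⟩ :=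
      (han ρ (mem_univ ρ)).exists_eventuallyEq_pow_smul_nonzero_iff.2 hnz
    have hpos : 0 < ‖g₀ ρ‖ := norm_pos_iff.2 hg₀ρ
    have hlow : ∀ᶠ z in 𝓝 ρ, ‖g₀ ρ‖ / 2 < ‖g₀ z‖ :=
      hg₀.continuousAt.norm.eventually (lt_mem_nhds (by linarith))
    obtain ⟨ε, hε, hball⟩ := Metric.eventually_nhds_iff.1 (hfg.and hlow)
    have hz : ∀ (δ t : ℝ), ((b + δ : ℝ) : ℂ) + t * Complex.I - ρ =
        (δ : ℂ) + ((t - γ : ℝ) : ℂ) * Complex.I := fun δ t => by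
      rw [hρ]; push_cast; ring
    have hclose : ∀ δ t : ℝ, |δ| < ε / 2 → |t - γ| < ε / 2 →
        f ((b + δ : ℝ) + t * Complex.I) =
          ((δ : ℂ) + ((t - γ : ℝ) : ℂ) * Complex.I) ^ n * g₀ ((b + δ : ℝ) + t * Complex.I) ∧
        ‖g₀ ρ‖ / 2 < ‖g₀ ((b + δ : ℝ) + t * Complex.I)‖ := fun δ t hδ ht => by
      have := @hball ((b + δ : ℝ) + t * Complex.I) (by
        rw [dist_eq_norm, hz]
        calc _ ≤ ‖(δ : ℂ)‖ + ‖((t - γ : ℝ) : ℂ) * Complex.I‖ := norm_add_le _ _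
          _ < ε := by
            rw [norm_mul, Complex.norm_I, mul_one, Complex.norm_real, Complex.norm_real,
              Real.norm_eq_abs, Real.norm_eq_abs]
            linarith)
      rwa [hz, smul_eq_mul] at this
    have h0 : ∀ t : ℝ, |t - γ| < ε / 2 → f (b + t * Complex.I) = 0 → n ≠ 0 ∧ t = γ := by
      intro t ht h
      obtain ⟨h1, h2⟩ := hclose 0 t (by simpa using hε) ht
      simp only [add_zero, Complex.ofReal_zero, zero_add] at h1 h2
      rw [h] at h1
      have h3 : g₀ (b + t * Complex.I) ≠ 0 := fun h3 => by
        rw [h3, norm_zero] at h2; linarith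
      have h4 : (((t - γ : ℝ) : ℂ) * Complex.I) ^ n = 0 :=
        (mul_eq_zero.1 h1.symm).resolve_right h3
      refine ⟨fun hn => by simp [hn] at h4, ?_⟩
      have h5 := (pow_eq_zero_iff (fun hn => by simp [hn] at h4)).1 h4
      have h6 : t - γ = 0 := by
        exact_mod_cast (mul_eq_zero.1 h5).resolve_right Complex.I_ne_zero
      linarith
    refine ⟨Metric.ball γ (ε / 2),
      mem_nhdsWithin_of_mem_nhds (Metric.ball_mem_nhds γ (half_pos hε)),
      (finite_singleton γ).subset ?_, fun t => n * |(log |t - γ|)| + |log (‖g₀ ρ‖ / 2)|,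
      fun t => by positivity, fun x y => ?_, ?_⟩
    · rintro t ⟨ht, ht0⟩
      exact (h0 t (by simpa [Real.dist_eq] using ht) ht0).2
    · exact ((intervalIntegrable_abs_log_abs_sub γ x y).const_mul _).add
        intervalIntegrable_const
    · filter_upwards [Ioo_mem_nhdsGT (half_pos hε)] with δ hδ t ht htf
      have ht' : |t - γ| < ε / 2 := by simpa [Real.dist_eq] using ht
      obtain ⟨h1, h2⟩ := hclose δ t (by rw [abs_of_pos hδ.1]; exact hδ.2) ht'
      have hg0 : ‖g₀ ((b + δ : ℝ) + t * Complex.I)‖ ≠ 0 := by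
        have := half_pos hpos; linarith
      set v : ℂ := (δ : ℂ) + ((t - γ : ℝ) : ℂ) * Complex.I with hv
      have hvre : v.re = δ := by simp [hv]
      have hvim : v.im = t - γ := by simp [hv]
      have hv0 : ‖v‖ ≠ 0 := norm_ne_zero_iff.2 fun h => by
        rw [h] at hvre; simp at hvre; linarith [hδ.1]
      rw [h1, norm_mul, norm_pow, log_mul (pow_ne_zero _ hv0) hg0, log_pow, neg_add]
      have h3 : -log ‖g₀ ((b + δ : ℝ) + t * Complex.I)‖ ≤ |log (‖g₀ ρ‖ / 2)| := by
        have := log_le_log (half_pos hpos) h2.le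
        have := neg_abs_le (log (‖g₀ ρ‖ / 2))
        linarith
      have h4 : -(n * log ‖v‖) ≤ n * |(log |t - γ|)| := by
        rcases eq_or_ne n 0 with rfl | hn
        · simp
        have htγ : t ≠ γ := by
          rintro rfl
          apply htf
          obtain ⟨h5, -⟩ := hclose 0 t (by simpa using hε) ht'
          simp only [add_zero, Complex.ofReal_zero, sub_self, zero_mul, zero_pow hn] at h5
          exact h5
        rw [← mul_neg]
        gcongr
        have h6 := Complex.abs_im_le_norm v
        rw [hvim] at h6
        have := log_le_log (abs_pos.2 (sub_ne_zero.2 htγ)) h6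
        have := neg_abs_le (log |t - γ|)
        linarith
      linarith

lemma one_add_norm_le {s : ℂ} {X : ℝ} (hX : |s.re| ≤ X) : 1 + ‖s‖ ≤ (1 + X) * (1 + |s.im|) := by
  have h1 := Complex.norm_le_abs_re_add_abs_im s
  have h2 := abs_nonneg s.im
  have h3 := (abs_nonneg _).trans hX
  nlinarith

lemma ofReal_add_mul_I_re (x t : ℝ) : ((x : ℂ) + t * Complex.I).re = x := by
  rw [Complex.add_re, Complex.ofReal_re, Complex.re_ofReal_mul]; simp

lemma ofReal_add_mul_I_im (x t : ℝ) : ((x : ℂ) + t * Complex.I).im = t := by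
  rw [Complex.add_im, Complex.ofReal_im, Complex.im_ofReal_mul]; simp

/-- If `f` has no zeros to the right of the line `Re s = b`, but possibly zeros on it, the mean
value inequality for `log ‖f‖` in the strip bounded by this line also holds in the other direction.
Shifts of the line to the right reduce this to the case without boundary zeros. The tails are
uniformly small, since the means with the more slowly decaying weight of parameter `a / 2` are
bounded. -/
lemma logLineMean_add_le_of_ne_zero {a b A : ℝ} {f : ℂ → ℂ} (ha : 0 < a)
    (hf : Differentiable ℂ f) (hA : 0 ≤ A)
    (hup : ∀ s : ℂ, b ≤ s.re → log ‖f s‖ ≤ A * (1 + ‖s‖))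
    (hf0 : ∀ s : ℂ, b < s.re → f s ≠ 0)
    (hlow : ∀ β > b, ∃ C : ℝ, 0 ≤ C ∧ ∀ s : ℂ, β ≤ s.re → |log ‖f s‖| ≤ C * (1 + ‖s‖)) :
    logLineMean a f b + logLineMean a f (b + π / a) ≤ log ‖f ((b + π / (2 * a) : ℝ) : ℂ)‖ := by
  have hw : 0 < π / (2 * a) := by positivity
  have hw2 : π / a = 2 * (π / (2 * a)) := by field_simp
  set w := π / (2 * a) with hwdef
  have hw' : π / (2 * (a / 2)) = 2 * w := by rw [← hw2]; field_simp
  rw [hw2]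
  have ha' : 0 < a / 2 := half_pos ha
  have hκ := fun t => sechKernel_pos ha t
  have hκ' := fun t => sechKernel_pos ha' t
  set X : ℝ := |b| + 1 + 4 * w with hX
  have hX0 : 0 ≤ X := by positivity
  have hXb : ∀ x : ℝ, b ≤ x → x ≤ b + 1 + 4 * w → |x| ≤ X := fun x h1 h2 => by
    rw [abs_le, hX]
    have := neg_abs_le b
    have := le_abs_self b
    constructor <;> linarith
  -- upper bound in all strips under consideration
  set A₁ := A * (1 + X) with hA₁
  have hA₁0 : 0 ≤ A₁ := by positivity
  have hup' : ∀ s : ℂ, b ≤ s.re → s.re ≤ b + 1 + 4 * w → log ‖f s‖ ≤ A₁ * (1 + |s.im|) :=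
    fun s h1 h2 => by
      refine (hup s h1).trans ?_
      have := one_add_norm_le (hXb _ h1 h2)
      calc A * (1 + ‖s‖) ≤ A * ((1 + X) * (1 + |s.im|)) := by gcongr
        _ = _ := by rw [hA₁]; ring
  have hup'' : ∀ β, b ≤ β → β ≤ b + 1 + 4 * w → ∀ t : ℝ,
      log ‖f (β + t * Complex.I)‖ ≤ A₁ * (1 + |t|) := fun β h1 h2 t => by
    have := hup' (β + t * Complex.I) (by rwa [ofReal_add_mul_I_re])
      (by rwa [ofReal_add_mul_I_re])
    rwa [ofReal_add_mul_I_im] at this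
  -- lower bound away from the line
  obtain ⟨C, hC0, hC⟩ := hlow (b + w) (by linarith)
  have hC' : ∀ β, b + w ≤ β → β ≤ b + 1 + 4 * w → ∀ t : ℝ,
      |log ‖f (β + t * Complex.I)‖| ≤ C * (1 + X) * (1 + |t|) := fun β h1 h2 t => by
    have h3 := hC (β + t * Complex.I) (by rwa [ofReal_add_mul_I_re])
    have h4 := one_add_norm_le (s := β + t * Complex.I) (X := X)
      (by rw [ofReal_add_mul_I_re]; exact hXb _ (by linarith) h2)
    rw [ofReal_add_mul_I_im] at h4
    calc _ ≤ _ := h3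
      _ ≤ C * ((1 + X) * (1 + |t|)) := by gcongr
      _ = _ := by ring
  have hI1 := integrable_sechKernel_mul_one_add_abs ha
  have hI1' := integrable_sechKernel_mul_one_add_abs ha'
  set k := ∫ t, sechKernel a t * (1 + |t|) with hk
  set k' := ∫ t, sechKernel (a / 2) t * (1 + |t|) with hk'
  set D : ℝ → ℝ → ℝ := fun δ t => A₁ * (1 + |t|) - log ‖f ((b + δ : ℝ) + t * Complex.I)‖ with hD
  have hD0 : ∀ δ ∈ Icc (0 : ℝ) 1, ∀ t, 0 ≤ D δ t := fun δ hδ t =>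
    sub_nonneg.2 (hup'' _ (by linarith [hδ.1]) (by linarith [hδ.2]) t)
  -- integrability for the weight of parameter `a / 2`, with a uniform bound
  set C₅ : ℝ := A₁ * k' + (A₁ * k' + C * (1 + X)) with hC₅
  have hslow : ∀ δ ∈ Icc (0 : ℝ) 1,
      Integrable (fun t => sechKernel (a / 2) t * D δ t) ∧
      ∫ t, sechKernel (a / 2) t * D δ t ≤ C₅ := fun δ hδ => by
    have hc0 : f ((b + δ + 2 * w : ℝ) : ℂ) ≠ 0 :=
      hf0 _ (by rw [Complex.ofReal_re]; linarith [hδ.1])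
    obtain ⟨h1, h2, h3⟩ := log_norm_le_logLineMean_add (c := b + δ + 2 * w) (C := A₁) ha' hf hA₁0
      (fun s hs => by
        rw [hw', abs_le] at hs
        exact hup' s (by linarith [hδ.1]) (by linarith [hδ.2])) hc0
    rw [hw', show b + δ + 2 * w - 2 * w = b + δ by ring] at h1 h3
    rw [hw'] at h2
    rw [show b + δ + 2 * w + 2 * w = b + δ + 4 * w by ring] at h2 h3
    have h4 : logLineMean (a / 2) f (b + δ + 4 * w) ≤ A₁ * k' := by
      rw [hk', ← integral_const_mul]
      refine integral_mono h2 (hI1'.const_mul A₁) fun t => ?_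
      have := mul_le_mul_of_nonneg_left
        (hup'' (b + δ + 4 * w) (by linarith [hδ.1]) (by linarith [hδ.2]) t) (hκ' t).le
      simp only; linarith
    have h5 : -(C * (1 + X)) ≤ log ‖f ((b + δ + 2 * w : ℝ) : ℂ)‖ := by
      have := hC' (b + δ + 2 * w) (by linarith [hδ.1]) (by linarith [hδ.2]) 0
      simp only [Complex.ofReal_zero, zero_mul, add_zero, abs_zero, mul_one] at this
      exact (abs_le.1 this).1
    have h6 : ∀ t, sechKernel (a / 2) t * D δ t = A₁ * (sechKernel (a / 2) t * (1 + |t|)) -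
        sechKernel (a / 2) t * log ‖f ((b + δ : ℝ) + t * Complex.I)‖ := fun t => by
      simp only [hD]; ring
    simp_rw [h6]
    refine ⟨(hI1'.const_mul A₁).sub h1, ?_⟩
    rw [integral_sub (hI1'.const_mul A₁) h1, integral_const_mul, ← hk']
    have h7 : ∫ t, sechKernel (a / 2) t * log ‖f ((b + δ : ℝ) + t * Complex.I)‖ =
      logLineMean (a / 2) f (b + δ) := rfl
    rw [h7]; linarith
  -- comparison of the two weights
  have hcmp : ∀ T : ℝ, 0 ≤ T → ∀ t : ℝ, T ≤ |t| →
      sechKernel a t ≤ 2 / cosh (a / 2 * T) * sechKernel (a / 2) t := fun T hT t ht => by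
    have h1 := sechKernel_mul_cosh_le ha t
    have h2 : cosh (a / 2 * T) ≤ cosh (a / 2 * t) := by
      rw [cosh_le_cosh, abs_mul, abs_mul, abs_of_nonneg hT]
      gcongr
    have h3 := cosh_pos (a / 2 * T)
    rw [div_mul_eq_mul_div, le_div_iff₀ h3]
    exact (mul_le_mul_of_nonneg_left h2 (hκ t).le).trans h1
  have hfast : ∀ δ ∈ Icc (0 : ℝ) 1, Integrable (fun t => sechKernel a t * D δ t) := fun δ hδ => by
    refine ((hslow δ hδ).1.const_mul 2).mono' ?_ (Eventually.of_forall fun t => ?_)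
    · exact ((continuous_sechKernel a).measurable.mul
        ((by fun_prop : Continuous fun t : ℝ => A₁ * (1 + |t|)).measurable.sub
          (measurable_log_norm_line hf.continuous (b + δ)))).aestronglyMeasurable
    · have h1 := hcmp 0 le_rfl t (abs_nonneg t)
      have h2 := hD0 δ hδ t
      rw [mul_zero, cosh_zero, div_one] at h1
      rw [norm_of_nonneg (mul_nonneg (hκ t).le h2), ← mul_assoc]
      gcongr
  have hfastU : ∀ δ ∈ Icc (0 : ℝ) 1,
      Integrable (fun t => sechKernel a t * log ‖f ((b + δ : ℝ) + t * Complex.I)‖) ∧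
      ∫ t, sechKernel a t * D δ t = A₁ * k - logLineMean a f (b + δ) := fun δ hδ => by
    have h6 : ∀ t, sechKernel a t * D δ t = A₁ * (sechKernel a t * (1 + |t|)) -
        sechKernel a t * log ‖f ((b + δ : ℝ) + t * Complex.I)‖ := fun t => by
      simp only [hD]; ring
    have h1 : Integrable (fun t => sechKernel a t * log ‖f ((b + δ : ℝ) + t * Complex.I)‖) := by
      refine ((hI1.const_mul A₁).sub (hfast δ hδ)).congr (Eventually.of_forall fun t => ?_)
      simp only [Pi.sub_apply, h6]; ring
    refine ⟨h1, ?_⟩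
    simp_rw [h6]
    rw [integral_sub (hI1.const_mul A₁) h1, integral_const_mul]
    rfl
  have hδev : ∀ᶠ δ in 𝓝[>] (0 : ℝ), δ ∈ Ioo (0 : ℝ) 1 := Ioo_mem_nhdsGT one_pos
  have hcont : ∀ (β t : ℝ), Tendsto (fun δ : ℝ => ‖f ((β + δ : ℝ) + t * Complex.I)‖) (𝓝[>] 0)
      (𝓝 ‖f (β + t * Complex.I)‖) := fun β t => by
    have h : Continuous (fun δ : ℝ => ‖f ((β + δ : ℝ) + t * Complex.I)‖) := by
      have := hf.continuous
      fun_prop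
    have h2 := (h.tendsto 0).mono_left (nhdsWithin_le_nhds (s := Ioi 0))
    simpa using h2
  -- the mean value property on the shifted strips
  have hshift : ∀ δ ∈ Ioo (0 : ℝ) 1,
      logLineMean a f (b + δ) + logLineMean a f (b + 2 * w + δ) =
        log ‖f ((b + w + δ : ℝ) : ℂ)‖ := fun δ hδ => by
    obtain ⟨C', hC'0, hC'⟩ := hlow (b + δ) (by linarith [hδ.1])
    have h := (logLineMean_add_eq_of_ne_zero (c := b + w + δ) (C := C' * (1 + X)) ha hf
      (by positivity) (fun s hs => by
        rw [← hwdef, abs_le] at hs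
        refine (hC' s (by linarith)).trans ?_
        have := one_add_norm_le (hXb s.re (by linarith [hδ.1]) (by linarith [hδ.2]))
        calc C' * (1 + ‖s‖) ≤ C' * ((1 + X) * (1 + |s.im|)) := by gcongr
          _ = _ := by ring) (fun s hs => by
        rw [← hwdef, abs_le] at hs
        exact hf0 s (by linarith [hδ.1]))).2.2
    rw [← hwdef, show b + w + δ - w = b + δ by ring,
      show b + w + δ + w = b + 2 * w + δ by ring] at h
    exact h
  have hlimr : Tendsto (fun δ => logLineMean a f (b + 2 * w + δ)) (𝓝[>] 0)
      (𝓝 (logLineMean a f (b + 2 * w))) := by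
    refine tendsto_integral_filter_of_dominated_convergence
      (fun t => C * (1 + X) * (sechKernel a t * (1 + |t|))) (Eventually.of_forall fun δ =>
        ((continuous_sechKernel a).measurable.mul
          (measurable_log_norm_line hf.continuous _)).aestronglyMeasurable) ?_
      (hI1.const_mul _) (Eventually.of_forall fun t => ?_)
    · filter_upwards [hδev] with δ hδ
      refine Eventually.of_forall fun t => ?_
      rw [norm_mul, norm_of_nonneg (hκ t).le, Real.norm_eq_abs]
      have := mul_le_mul_of_nonneg_left (hC' (b + 2 * w + δ) (by linarith [hδ.1])
        (by linarith [hδ.2]) t) (hκ t).le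
      linarith
    · exact ((continuousAt_log (norm_ne_zero_iff.2 (hf0 _ (by
        rw [ofReal_add_mul_I_re]; linarith)))).tendsto.comp (hcont (b + 2 * w) t)).const_mul _
  have hlimc : Tendsto (fun δ : ℝ => log ‖f ((b + w + δ : ℝ) : ℂ)‖) (𝓝[>] 0)
      (𝓝 (log ‖f ((b + w : ℝ) : ℂ)‖)) := by
    have h0 : f ((b + w : ℝ) : ℂ) ≠ 0 := hf0 _ (by rw [Complex.ofReal_re]; linarith)
    have h1 := hcont (b + w) 0
    simp only [Complex.ofReal_zero, zero_mul, add_zero] at h1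
    exact (continuousAt_log (norm_ne_zero_iff.2 h0)).tendsto.comp h1
  set Λ := log ‖f ((b + w : ℝ) : ℂ)‖ - logLineMean a f (b + 2 * w) with hΛ
  have hliml : Tendsto (fun δ => logLineMean a f (b + δ)) (𝓝[>] 0) (𝓝 Λ) := by
    refine (hlimc.sub hlimr).congr' ?_
    filter_upwards [hδev] with δ hδ
    rw [← hshift δ hδ]; ring
  -- convergence on compact pieces of the line
  have hloc : ∀ T : ℝ, 0 ≤ T → Tendsto (fun δ => ∫ t in Icc (-T) T, sechKernel a t * D δ t)
      (𝓝[>] 0) (𝓝 (∫ t in Icc (-T) T, sechKernel a t * D 0 t)) := fun T hT => by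
    obtain ⟨hfin, g, hg0, hg, hgb⟩ := exists_intervalIntegrable_majorant hf
      (hf0 ((b + w : ℝ) : ℂ) (by rw [Complex.ofReal_re]; linarith)) b
      (isCompact_Icc (a := -T) (b := T))
    have hae : ∀ᵐ t ∂(volume.restrict (Icc (-T) T)),
        t ∈ Icc (-T) T ∧ f (b + t * Complex.I) ≠ 0 := by
      rw [ae_restrict_iff' measurableSet_Icc]
      have h0 : ∀ᵐ t : ℝ, t ∉ {t ∈ Icc (-T) T | f (b + t * Complex.I) = 0} :=
        measure_eq_zero_iff_ae_notMem.1 (hfin.measure_zero volume)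
      filter_upwards [h0] with t ht htT
      exact ⟨htT, fun h => ht ⟨htT, h⟩⟩
    have hgI : IntegrableOn g (Icc (-T) T) := by
      rw [integrableOn_Icc_iff_integrableOn_Ioc, ← intervalIntegrable_iff_integrableOn_Ioc_of_le
        (by linarith)]
      exact hg _ _
    refine tendsto_integral_filter_of_dominated_convergence
      (fun t => A₁ * (sechKernel a t * (1 + |t|)) + sechKernel a t * g t)
      (Eventually.of_forall fun δ => ((continuous_sechKernel a).measurable.mul
        ((by fun_prop : Continuous fun t : ℝ => A₁ * (1 + |t|)).measurable.sub
          (measurable_log_norm_line hf.continuous (b + δ)))).aestronglyMeasurable) ?_ ?_ ?_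
    · filter_upwards [hδev, hgb] with δ hδ hgδ
      filter_upwards [hae] with t ht
      have h1 := hD0 δ ⟨hδ.1.le, hδ.2.le⟩ t
      rw [norm_of_nonneg (mul_nonneg (hκ t).le h1)]
      have h2 : D δ t ≤ A₁ * (1 + |t|) + g t := by
        have := hgδ t ht.1 ht.2
        simp only [hD]; linarith
      have := mul_le_mul_of_nonneg_left h2 (hκ t).le
      linarith
    · refine (hI1.const_mul A₁).integrableOn.add ?_
      exact hgI.continuousOn_mul (continuous_sechKernel a).continuousOn isCompact_Icc
    · filter_upwards [hae] with t ht
      have h1 := ((continuousAt_log (norm_ne_zero_iff.2 ht.2)).tendsto.comp (hcont b t))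
      simp only [hD, add_zero]
      exact (h1.const_sub _).const_mul _
  have hT : ∀ T : ℝ, 0 ≤ T →
      A₁ * k - Λ ≤ A₁ * k - logLineMean a f b + 2 / cosh (a / 2 * T) * C₅ := fun T hT => by
    have h1 : ∀ δ ∈ Icc (0 : ℝ) 1, A₁ * k - logLineMean a f (b + δ) ≤
        (∫ t in Icc (-T) T, sechKernel a t * D δ t) + 2 / cosh (a / 2 * T) * C₅ := fun δ hδ => by
      obtain ⟨hs1, hs2⟩ := hslow δ hδ
      rw [← (hfastU δ hδ).2, ← integral_add_compl (measurableSet_Icc (a := -T) (b := T))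
        (hfast δ hδ)]
      gcongr
      have hcp := cosh_pos (a / 2 * T)
      calc ∫ t in (Icc (-T) T)ᶜ, sechKernel a t * D δ t
          ≤ ∫ t in (Icc (-T) T)ᶜ, 2 / cosh (a / 2 * T) * (sechKernel (a / 2) t * D δ t) := by
            refine setIntegral_mono_on (hfast δ hδ).integrableOn (hs1.const_mul _).integrableOn
              measurableSet_Icc.compl fun t ht => ?_
            rw [← mul_assoc]
            refine mul_le_mul_of_nonneg_right (hcmp T hT t ?_) (hD0 δ hδ t)
            by_contra! h
            exact ht (abs_le.1 h.le)
        _ ≤ ∫ t, 2 / cosh (a / 2 * T) * (sechKernel (a / 2) t * D δ t) := by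
            refine setIntegral_le_integral (hs1.const_mul _) (Eventually.of_forall fun t => ?_)
            have := hD0 δ hδ t
            have := hκ' t
            simp only [Pi.zero_apply]
            positivity
        _ = 2 / cosh (a / 2 * T) * ∫ t, sechKernel (a / 2) t * D δ t := integral_const_mul _ _
        _ ≤ _ := by gcongr
    have h2 : A₁ * k - Λ ≤ (∫ t in Icc (-T) T, sechKernel a t * D 0 t) +
        2 / cosh (a / 2 * T) * C₅ := by
      refine le_of_tendsto_of_tendsto (hliml.const_sub _) ((hloc T hT).add_const _) ?_
      filter_upwards [hδev] with δ hδ using h1 δ ⟨hδ.1.le, hδ.2.le⟩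
    have h0 : (0 : ℝ) ∈ Icc (0 : ℝ) 1 := by simp
    have h3 : ∫ t in Icc (-T) T, sechKernel a t * D 0 t ≤ A₁ * k - logLineMean a f b := by
      have := (hfastU 0 h0).2
      rw [add_zero] at this
      rw [← this]
      refine setIntegral_le_integral (hfast 0 h0) (Eventually.of_forall fun t => ?_)
      exact mul_nonneg (hκ t).le (hD0 0 h0 t)
    linarith
  have hlimT : Tendsto (fun T : ℝ => A₁ * k - logLineMean a f b + 2 / cosh (a / 2 * T) * C₅) atTop
      (𝓝 (A₁ * k - logLineMean a f b)) := by
    have h1 : Tendsto (fun T : ℝ => cosh (a / 2 * T)) atTop atTop := by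
      refine tendsto_atTop_mono (f := fun T : ℝ => a / 2 * T / 2) (fun T => ?_) ?_
      · have := one_add_abs_le_mul_cosh (x := a / 2 * T)
        have := le_abs_self (a / 2 * T)
        linarith
      · exact (tendsto_id.const_mul_atTop ha').atTop_div_const two_pos
    have h2 := ((tendsto_const_nhds (x := (2 : ℝ))).div_atTop h1).mul_const C₅
    simpa using h2.const_add (A₁ * k - logLineMean a f b)
  have hfinal := ge_of_tendsto hlimT ((eventually_ge_atTop 0).mono fun T hT' => hT T hT')
  rw [hΛ] at hfinal
  linarith

/-! ### The mean of `log |ζ|` over a vertical line -/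

/-- An entire function which is not identically zero has only countably many zeros on a line. -/
lemma ae_ne_zero_on_line {f : ℂ → ℂ} (hf : Differentiable ℂ f) {z₁ : ℂ} (hz₁ : f z₁ ≠ 0) (b : ℝ) :
    ∀ᵐ t : ℝ, f (b + t * Complex.I) ≠ 0 := by
  have h : ({t : ℝ | f (b + t * Complex.I) = 0}).Countable := by
    have e : {t : ℝ | f (b + t * Complex.I) = 0} =
        ⋃ n : ℕ, {t ∈ Icc (-(n : ℝ)) n | f (b + t * Complex.I) = 0} := by
      ext t
      simp only [mem_ofPred_eq, mem_iUnion, exists_and_right]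
      refine ⟨fun h => ⟨?_, h⟩, fun h => h.2⟩
      obtain ⟨n, hn⟩ := exists_nat_ge |t|
      exact ⟨n, abs_le.1 hn⟩
    rw [e]
    exact countable_iUnion fun n =>
      (exists_intervalIntegrable_majorant hf hz₁ b isCompact_Icc).1.countable
  exact measure_eq_zero_iff_ae_notMem.1 (h.measure_zero volume)

/-- On a vertical line, `log |ζ|` is the difference of the logarithms of `(s - 1) ζ(s)` and
`s - 1`. This can fail at zeros, where both sides involve `log 0`, but these form a null set. -/
lemma logLineMean_riemannZeta_eq_sub {a β : ℝ} (hβ : β ≠ 1)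
    (h1 : Integrable fun t => sechKernel a t * log ‖riemannZeta₁ (β + t * Complex.I)‖)
    (h2 : Integrable fun t : ℝ => sechKernel a t * log ‖(β + t * Complex.I) - ((1 : ℝ) : ℂ)‖) :
    Integrable (fun t => sechKernel a t * log ‖riemannZeta (β + t * Complex.I)‖) ∧
    logLineMean a riemannZeta β =
      logLineMean a riemannZeta₁ β - logLineMean a (fun s => s - ((1 : ℝ) : ℂ)) β := by
  have hae : (fun t => sechKernel a t * log ‖riemannZeta₁ (β + t * Complex.I)‖ -
      sechKernel a t * log ‖(β + t * Complex.I) - ((1 : ℝ) : ℂ)‖) =ᵐ[volume]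
      fun t => sechKernel a t * log ‖riemannZeta (β + t * Complex.I)‖ := by
    filter_upwards [ae_ne_zero_on_line differentiable_riemannZeta₁ (z₁ := 1) (by simp) β] with t ht
    have hs1 : (β : ℂ) + t * Complex.I ≠ 1 := fun h => hβ (by
      have := congrArg Complex.re h
      rwa [ofReal_add_mul_I_re, Complex.one_re] at this)
    rw [riemannZeta₁_eq_mul hs1] at ht ⊢
    rw [norm_mul, log_mul (norm_ne_zero_iff.2 (left_ne_zero_of_mul ht))
      (norm_ne_zero_iff.2 (right_ne_zero_of_mul ht)), Complex.ofReal_one]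
    ring
  refine ⟨(h1.sub h2).congr hae, ?_⟩
  unfold logLineMean
  rw [← integral_sub h1 h2]
  exact (integral_congr_ae hae).symm

lemma riemannZeta₁_ne_zero_of_one_le_re {s : ℂ} (hs : 1 ≤ s.re) : riemannZeta₁ s ≠ 0 := by
  rcases eq_or_ne s 1 with rfl | h
  · simp
  · rw [riemannZeta₁_eq_mul h]
    exact mul_ne_zero (sub_ne_zero.2 h) (riemannZeta_ne_zero_of_one_le_re hs)

lemma log_norm_riemannZeta_eq_sub {s : ℂ} (hs : 1 < s.re) :
    log ‖riemannZeta s‖ = log ‖riemannZeta₁ s‖ - log ‖s - ((1 : ℝ) : ℂ)‖ := by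
  have h1 : s ≠ 1 := by rintro rfl; simp at hs
  rw [riemannZeta₁_eq_mul h1, norm_mul, log_mul (norm_ne_zero_iff.2 (sub_ne_zero.2 h1))
    (norm_ne_zero_iff.2 (riemannZeta_ne_zero_of_one_le_re hs.le)), Complex.ofReal_one]
  ring

/-- The mean value property for `log |ζ|` in strips to the right of `Re s = 1`. -/
lemma logLineMean_riemannZeta_add {a β : ℝ} (ha : 0 < a) (hβ : 1 < β) :
    Integrable (fun t => sechKernel a t * log ‖riemannZeta (β + t * Complex.I)‖) ∧
    logLineMean a riemannZeta β + logLineMean a riemannZeta (β + π / a) =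
      log ‖riemannZeta ((β + π / (2 * a) : ℝ) : ℂ)‖ := by
  have hw : 0 < π / (2 * a) := by positivity
  have hw2 : π / a = π / (2 * a) + π / (2 * a) := by field_simp; norm_num
  rw [hw2]
  set w := π / (2 * a) with hwdef
  set X := β + 2 * w with hX
  have hXs : ∀ s : ℂ, |s.re - (β + w)| ≤ w → β ≤ s.re ∧ |s.re| ≤ X := fun s hs => by
    rw [abs_le] at hs
    refine ⟨by linarith, ?_⟩
    rw [abs_of_pos (by linarith)]; linarith
  obtain ⟨C, hC0, hC⟩ := exists_abs_log_norm_riemannZeta₁_le (b := 1) (by norm_num) hβ one_lt_two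
    fun s hs => riemannZeta₁_ne_zero_of_one_le_re hs.le
  obtain ⟨l1, r1, e1⟩ := logLineMean_add_eq_of_ne_zero (c := β + w) (C := C * (1 + X)) ha
    differentiable_riemannZeta₁ (by positivity) (fun s hs => by
      obtain ⟨h1, h2⟩ := hXs s hs
      refine (hC s h1).trans ?_
      rw [mul_assoc]
      exact mul_le_mul_of_nonneg_left (one_add_norm_le h2) hC0) (fun s hs =>
      riemannZeta₁_ne_zero_of_one_le_re (hβ.le.trans (hXs s hs).1))
  have hX1 : 0 ≤ 1 + X := by positivity
  set C' := max (-log (β - 1)) (1 + X) with hC'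
  have hC'X : 1 + X ≤ C' := le_max_right _ _
  have hlow : ∀ s : ℂ, β ≤ s.re → β - 1 ≤ ‖s - ((1 : ℝ) : ℂ)‖ := fun s hs => by
    have h := (le_abs_self _).trans (Complex.abs_re_le_norm (s - ((1 : ℝ) : ℂ)))
    rw [Complex.sub_re, Complex.ofReal_re] at h
    linarith
  obtain ⟨l2, r2, e2⟩ := logLineMean_add_eq_of_ne_zero (f := fun s => s - ((1 : ℝ) : ℂ))
    (c := β + w) (C := C') ha (by fun_prop) (hX1.trans hC'X) (fun s hs => by
      obtain ⟨h1, h2⟩ := hXs s hs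
      have hu : ‖s - ((1 : ℝ) : ℂ)‖ ≤ 1 + ‖s‖ := (norm_sub_le _ _).trans (by
        rw [Complex.ofReal_one, norm_one]; linarith)
      have him : 1 ≤ 1 + |s.im| := by have := abs_nonneg s.im; linarith
      refine abs_log_le_of_le_of_le (by linarith) (hlow s h1) hu ?_ ?_
      · calc -log (β - 1) ≤ C' := le_max_left _ _
          _ ≤ C' * (1 + |s.im|) := le_mul_of_one_le_right (hX1.trans hC'X) him
      · refine (log_le_self (by positivity)).trans ((one_add_norm_le h2).trans ?_)
        gcongr) (fun s hs h => by
      have := hlow s (hXs s hs).1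
      rw [h, norm_zero] at this
      linarith)
  rw [← hwdef, show β + w - w = β by ring] at l1 l2 e1 e2
  rw [← hwdef] at r1 r2
  rw [show β + w + w = β + (w + w) by ring] at r1 r2 e1 e2
  obtain ⟨i1, f1⟩ := logLineMean_riemannZeta_eq_sub (by linarith) l1 l2
  obtain ⟨-, f2⟩ := logLineMean_riemannZeta_eq_sub (by linarith) r1 r2
  refine ⟨i1, ?_⟩
  rw [f1, f2, log_norm_riemannZeta_eq_sub (by rw [Complex.ofReal_re]; linarith)]
  linarith

/-- `log |ζ(s)|` decays exponentially as `Re s → ∞`. -/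
lemma exists_abs_log_norm_riemannZeta_le_rpow {σ : ℝ} (hσ : 1 < σ) :
    ∃ A : ℝ, 0 ≤ A ∧ ∀ s : ℂ, σ ≤ s.re → |log ‖riemannZeta s‖| ≤ A * 2 ^ (-s.re) := by
  obtain ⟨B, hB0, hB⟩ := exists_abs_log_norm_riemannZeta_le hσ
  obtain ⟨A, hA0, hA⟩ := exists_norm_riemannZeta_sub_one_le
  have hlim : Tendsto (fun x : ℝ => A * 2 ^ (-x)) atTop (𝓝 0) := by
    have h := (tendsto_rpow_atBot_of_base_gt_one 2 one_lt_two).comp tendsto_neg_atTop_atBot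
    simpa using h.const_mul A
  obtain ⟨N, hN⟩ := eventually_atTop.1 ((hlim.eventually (gt_mem_nhds (by norm_num :
    (0 : ℝ) < 1 / 2))).and (eventually_ge_atTop 2))
  have h2N : (0 : ℝ) < 2 ^ N := by positivity
  refine ⟨max (2 * A) (B * 2 ^ N), le_max_of_le_left (by positivity), fun s hs => ?_⟩
  have hp : (0 : ℝ) < 2 ^ (-s.re) := by positivity
  rcases le_or_gt N s.re with h | h
  · obtain ⟨h1, h2⟩ := hN s.re h
    have h3 := hA s h2
    set d := A * (2 : ℝ) ^ (-s.re) with hd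
    have hd0 : 0 ≤ d := by positivity
    have h4 : |‖riemannZeta s‖ - 1| ≤ d := by
      have := abs_norm_sub_norm_le (riemannZeta s) 1
      rw [norm_one] at this
      exact this.trans h3
    rw [abs_le] at h4
    have h6 : (1 : ℝ) / 2 ≤ ‖riemannZeta s‖ := by linarith
    have h5 : 0 < ‖riemannZeta s‖ := by linarith
    have h7 : |log ‖riemannZeta s‖| ≤ 2 * d := by
      have h8 := log_le_sub_one_of_pos h5
      have h9 := one_sub_inv_le_log_of_pos h5
      have h10 : ‖riemannZeta s‖⁻¹ ≤ 1 + 2 * d := by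
        rw [inv_le_iff_one_le_mul₀ h5]
        nlinarith
      rw [abs_le]; constructor <;> linarith
    calc _ ≤ 2 * d := h7
      _ = 2 * A * 2 ^ (-s.re) := by rw [hd]; ring
      _ ≤ _ := by gcongr; exact le_max_left _ _
  · calc _ ≤ B := hB s hs
      _ ≤ B * (2 ^ N * 2 ^ (-s.re)) := by
          refine le_mul_of_one_le_right hB0 ?_
          rw [← rpow_add two_pos]
          exact one_le_rpow one_le_two (by linarith)
      _ = B * 2 ^ N * 2 ^ (-s.re) := by ring
      _ ≤ _ := by gcongr; exact le_max_right _ _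

lemma tendsto_logLineMean_riemannZeta {a : ℝ} (ha : 0 < a) :
    Tendsto (logLineMean a riemannZeta) atTop (𝓝 0) := by
  obtain ⟨A, hA0, hA⟩ := exists_abs_log_norm_riemannZeta_le_rpow one_lt_two
  have hlim : Tendsto (fun β : ℝ => (∫ t, sechKernel a t) * (A * 2 ^ (-β))) atTop (𝓝 0) := by
    have h := (tendsto_rpow_atBot_of_base_gt_one 2 one_lt_two).comp tendsto_neg_atTop_atBot
    simpa using (h.const_mul A).const_mul (∫ t, sechKernel a t)
  refine squeeze_zero_norm' ?_ hlim
  filter_upwards [eventually_ge_atTop 2] with β hβ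
  rw [← integral_mul_const]
  refine norm_integral_le_of_norm_le ((integrable_sechKernel ha).mul_const _)
    (Eventually.of_forall fun t => ?_)
  have h0 := sechKernel_pos ha t
  rw [norm_mul, norm_of_nonneg h0.le, Real.norm_eq_abs]
  have := hA (β + t * Complex.I) (by rwa [ofReal_add_mul_I_re])
  rw [ofReal_add_mul_I_re] at this
  gcongr

lemma summable_log_norm_riemannZeta {a c : ℝ} (ha : 0 < a) (hc : 1 < c) :
    Summable fun n : ℕ => (-1 : ℝ) ^ n * log ‖riemannZeta ((c + π / a * n : ℝ) : ℂ)‖ := by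
  obtain ⟨A, hA0, hA⟩ := exists_abs_log_norm_riemannZeta_le_rpow hc
  have hw : 0 < π / a := by positivity
  have hr : (2 : ℝ) ^ (-(π / a)) < 1 := rpow_lt_one_of_one_lt_of_neg one_lt_two (by linarith)
  refine Summable.of_norm_bounded
    ((summable_geometric_of_lt_one (by positivity) hr).mul_left (A * 2 ^ (-c))) fun n => ?_
  have h := hA ((c + π / a * n : ℝ) : ℂ) (by
    rw [Complex.ofReal_re]
    have : 0 ≤ π / a * n := by positivity
    linarith)
  rw [norm_mul, norm_pow, norm_neg, norm_one, one_pow, one_mul, Real.norm_eq_abs]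
  refine h.trans (le_of_eq ?_)
  rw [Complex.ofReal_re, mul_assoc, ← rpow_natCast, ← rpow_mul zero_le_two, ← rpow_add two_pos]
  congr 2; ring

/-- Summing the mean value property over consecutive strips to the right of `Re s = 1`. -/
lemma logLineMean_riemannZeta_eq_tsum {a β : ℝ} (ha : 0 < a) (hβ : 1 < β) :
    logLineMean a riemannZeta β =
      ∑' n : ℕ, (-1 : ℝ) ^ n * log ‖riemannZeta ((β + π / (2 * a) + π / a * n : ℝ) : ℂ)‖ := by
  have hw : 0 < π / a := by positivity
  have hw' : 0 < π / (2 * a) := by positivity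
  have hS := summable_log_norm_riemannZeta (c := β + π / (2 * a)) ha (by linarith)
  refine tendsto_nhds_unique (f := fun N : ℕ => ∑ n ∈ Finset.range N,
    (-1 : ℝ) ^ n * log ‖riemannZeta ((β + π / (2 * a) + π / a * n : ℝ) : ℂ)‖) (l := atTop)
    ?_ hS.hasSum.tendsto_sum_nat
  have hpart : ∀ N : ℕ, ∑ n ∈ Finset.range N,
      (-1 : ℝ) ^ n * log ‖riemannZeta ((β + π / (2 * a) + π / a * n : ℝ) : ℂ)‖ =
      logLineMean a riemannZeta β - (-1) ^ N * logLineMean a riemannZeta (β + π / a * N) := by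
    intro N
    induction N with
    | zero => simp
    | succ N ih =>
      have h := (logLineMean_riemannZeta_add (β := β + π / a * N) ha (by
        have : 0 ≤ π / a * N := by positivity
        linarith)).2
      rw [Finset.sum_range_succ, ih,
        show β + π / (2 * a) + π / a * N = β + π / a * N + π / (2 * a) by ring, ← h]
      push_cast
      rw [show β + π / a * (N + 1) = β + π / a * N + π / a by ring]
      ring
  simp_rw [hpart]
  have h1 : Tendsto (fun N : ℕ => β + π / a * N) atTop atTop :=
    tendsto_atTop_add_const_left _ _ (tendsto_natCast_atTop_atTop.const_mul_atTop hw)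
  have h2 := (tendsto_logLineMean_riemannZeta ha).comp h1
  have h3 : Tendsto (fun N : ℕ => (-1 : ℝ) ^ N * logLineMean a riemannZeta (β + π / a * N)) atTop
      (𝓝 0) := by
    rw [tendsto_zero_iff_norm_tendsto_zero] at h2 ⊢
    refine h2.congr fun N => ?_
    rw [norm_mul, norm_pow, norm_neg, norm_one, one_pow, one_mul]; rfl
  simpa using h3.const_sub (logLineMean a riemannZeta β)

lemma one_lt_strip_center {a b : ℝ} (ha : 0 < a) (hab : a * (1 - b) < π / 2) :
    1 < b + π / (2 * a) := by
  have : 1 - b < π / (2 * a) := by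
    rw [lt_div_iff₀ (by positivity)]; linarith
  linarith

/-- The defect in the mean value property of `log |(s - 1) ζ(s)|` for the strip of width `π / a`
with left edge `Re s = b`. By Jensen's formula it measures the zeros in the strip. -/
noncomputable def zetaStripDefect (a b : ℝ) : ℝ :=
  logLineMean a riemannZeta₁ b + logLineMean a riemannZeta₁ (b + π / a) -
    log ‖riemannZeta₁ ((b + π / (2 * a) : ℝ) : ℂ)‖

lemma log_norm_riemannZeta₁_le_of_strip {b c w : ℝ} (hb : 1 / 2 ≤ b) (hbc : b = c - w)
    {s : ℂ} (hs : |s.re - c| ≤ w) :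
    log ‖riemannZeta₁ s‖ ≤ 2 * (1 + (c + w)) * (1 + |s.im|) := by
  rw [abs_le] at hs
  refine (log_norm_riemannZeta₁_le (by linarith)).trans ?_
  rw [mul_assoc]
  refine mul_le_mul_of_nonneg_left (one_add_norm_le ?_) zero_le_two
  rw [abs_of_pos (by linarith)]; linarith

/-- The centre of the strip lies to the right of `Re s = 1`, and so does its right-hand edge: all
zeros with `Re s > b` lie in the strip. A zero makes the defect positive, and without zeros the
defect vanishes, even if there are zeros on the line `Re s = b` itself. -/
lemma zetaStripDefect_eq_zero_iff {a b : ℝ} (hb : 1 / 2 ≤ b) (hb1 : b < 1) (ha : 0 < a)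
    (hab : a * (1 - b) < π / 2) :
    zetaStripDefect a b = 0 ↔ ∀ s : ℂ, s ≠ 1 → b < s.re → riemannZeta s ≠ 0 := by
  have hw : 0 < π / (2 * a) := by positivity
  have hw2 : π / a = 2 * (π / (2 * a)) := by field_simp
  have hc := one_lt_strip_center ha hab
  have hfc : riemannZeta₁ ((b + π / (2 * a) : ℝ) : ℂ) ≠ 0 :=
    riemannZeta₁_ne_zero_of_one_le_re (by rw [Complex.ofReal_re]; exact hc.le)
  have hup : ∀ s : ℂ, |s.re - (b + π / (2 * a))| ≤ π / (2 * a) → log ‖riemannZeta₁ s‖ ≤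
      2 * (1 + (b + π / (2 * a) + π / (2 * a))) * (1 + |s.im|) :=
    fun s hs => log_norm_riemannZeta₁_le_of_strip hb (by ring) hs
  constructor
  · intro h s hs1 hsb h0
    have hs : s.re < 1 := by
      by_contra! hs
      exact riemannZeta_ne_zero_of_one_le_re hs h0
    have hlt := log_norm_lt_logLineMean_add ha differentiable_riemannZeta₁ (by positivity) hup hfc
      (z := s) (by rw [abs_lt]; constructor <;> linarith)
      (by rw [riemannZeta₁_eq_mul hs1, h0, mul_zero])
    rw [add_sub_cancel_right, add_assoc, ← two_mul, ← hw2] at hlt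
    unfold zetaStripDefect at h
    linarith
  · intro h
    have hne : ∀ s : ℂ, b < s.re → riemannZeta₁ s ≠ 0 := fun s hs => by
      rcases eq_or_ne s 1 with rfl | hs1
      · simp
      · rw [riemannZeta₁_eq_mul hs1]
        exact mul_ne_zero (sub_ne_zero.2 hs1) (h s hs1 hs)
    have hle := (log_norm_le_logLineMean_add ha differentiable_riemannZeta₁ (by positivity) hup
      hfc).2.2
    rw [add_sub_cancel_right, add_assoc, ← two_mul, ← hw2] at hle
    have hge := logLineMean_add_le_of_ne_zero ha differentiable_riemannZeta₁ zero_le_two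
      (fun s hs => log_norm_riemannZeta₁_le (hb.trans hs)) hne
      (fun β hβ => exists_abs_log_norm_riemannZeta₁_le hb hβ (hb1.trans one_lt_two) hne)
    unfold zetaStripDefect
    linarith

/-- The value of the mean of `log |ζ|` on the line `Re s = b`. The pole of `ζ` in the strip
contributes the first term, the strips further to the right the series. -/
lemma logLineMean_riemannZeta_eq {a b : ℝ} (hb : 1 / 2 ≤ b) (hb1 : b < 1) (ha : 0 < a)
    (hab : a * (1 - b) < π / 2) :
    Integrable (fun t => sechKernel a t * log ‖riemannZeta (b + t * Complex.I)‖) ∧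
    logLineMean a riemannZeta b =
      1 / 2 * log ((1 - sin (a * (1 - b))) / (1 + sin (a * (1 - b)))) +
      (∑' n : ℕ, (-1 : ℝ) ^ n * log ‖riemannZeta ((b + π / (2 * a) + π / a * n : ℝ) : ℂ)‖) +
      zetaStripDefect a b := by
  have hw : 0 < π / (2 * a) := by positivity
  have hw2 : π / a = 2 * (π / (2 * a)) := by field_simp
  have hc := one_lt_strip_center ha hab
  have hfc : riemannZeta₁ ((b + π / (2 * a) : ℝ) : ℂ) ≠ 0 :=
    riemannZeta₁_ne_zero_of_one_le_re (by rw [Complex.ofReal_re]; exact hc.le)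
  obtain ⟨l1, r1, -⟩ := log_norm_le_logLineMean_add ha differentiable_riemannZeta₁
    (C := 2 * (1 + (b + π / (2 * a) + π / (2 * a)))) (by positivity)
    (fun s hs => log_norm_riemannZeta₁_le_of_strip hb (by ring) hs) hfc
  obtain ⟨l2, r2, e2⟩ := logLineMean_add_sub_const (c := b + π / (2 * a)) (x := 1) ha
    (by rw [abs_lt]; constructor <;> linarith) (by linarith)
  rw [add_sub_cancel_right] at l1 l2 e2
  rw [add_assoc, ← two_mul, ← hw2] at r1 r2
  rw [add_assoc b (π / (2 * a)) (π / (2 * a)), ← two_mul, ← hw2] at e2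
  obtain ⟨i1, f1⟩ := logLineMean_riemannZeta_eq_sub hb1.ne l1 l2
  obtain ⟨-, f2⟩ := logLineMean_riemannZeta_eq_sub (by linarith) r1 r2
  refine ⟨i1, ?_⟩
  rw [← log_norm_stripInv_ofReal ha (mul_pos ha (by linarith)) hab]
  have hS := summable_log_norm_riemannZeta ha hc
  rw [hS.tsum_eq_zero_add]
  have ht := logLineMean_riemannZeta_eq_tsum (β := b + π / a) ha (by linarith)
  have e3 : ∑' n : ℕ, (-1 : ℝ) ^ (n + 1) *
      log ‖riemannZeta ((b + π / (2 * a) + π / a * ((n + 1 : ℕ) : ℝ) : ℝ) : ℂ)‖ =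
      -logLineMean a riemannZeta (b + π / a) := by
    rw [ht, ← tsum_neg]
    congr 1; ext n
    rw [show b + π / (2 * a) + π / a * ((n + 1 : ℕ) : ℝ) = b + π / a + π / (2 * a) + π / a * n by
      push_cast; ring]
    ring
  rw [e3, f1, f2, pow_zero, one_mul, Nat.cast_zero, mul_zero, add_zero,
    log_norm_riemannZeta_eq_sub (by rw [Complex.ofReal_re]; exact hc)]
  unfold zetaStripDefect
  linarith

lemma logZetaCoshIntegrand_eq {a : ℝ} (ha : 0 < a) (b t : ℝ) :
    logZetaCoshIntegrand a b t =
      2 * π / a * (sechKernel a t * log ‖riemannZeta (b + t * Complex.I)‖) := by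
  have h1 := pi_pos
  have h2 := cosh_pos (a * t)
  unfold logZetaCoshIntegrand sechKernel
  field_simp

lemma logZetaCoshIntegrand_abs (a b t : ℝ) :
    logZetaCoshIntegrand a b |t| = logZetaCoshIntegrand a b t := by
  rcases abs_choice t with h | h
  · rw [h]
  · rw [h]
    unfold logZetaCoshIntegrand
    have e : (b : ℂ) + ((-t : ℝ) : ℂ) * Complex.I =
        (starRingEnd ℂ) ((b : ℂ) + (t : ℂ) * Complex.I) := by
      simp
    rw [e, riemannZeta_conj, Complex.norm_conj, mul_neg, cosh_neg]

/-- By the symmetry `ζ(s̄) = conj ζ(s)` the mean over the line is the integral over a half-line. -/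
lemma integral_logZetaCoshIntegrand {a : ℝ} (ha : 0 < a) (b : ℝ) :
    a / π * ∫ t in Ioi (0 : ℝ), logZetaCoshIntegrand a b t = logLineMean a riemannZeta b := by
  have h := integral_comp_abs (f := logZetaCoshIntegrand a b)
  simp_rw [logZetaCoshIntegrand_abs, logZetaCoshIntegrand_eq ha] at h
  rw [integral_const_mul] at h
  have e : ∫ t in Ioi (0 : ℝ), logZetaCoshIntegrand a b t = ∫ t in Ioi (0 : ℝ),
      2 * π / a * (sechKernel a t * log ‖riemannZeta (b + t * Complex.I)‖) := by
    simp_rw [logZetaCoshIntegrand_eq ha]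
  have h' : logLineMean a riemannZeta b =
    ∫ t, sechKernel a t * log ‖riemannZeta (b + t * Complex.I)‖ := rfl
  rw [← h', ← e] at h
  generalize ∫ t in Ioi (0 : ℝ), logZetaCoshIntegrand a b t = J at h ⊢
  have hp := pi_pos
  field_simp at h ⊢
  linarith

lemma logZetaTerm_eq {a b : ℝ} (ha : 0 < a) (hab : a * (1 - b) < π / 2) (n : ℕ) :
    logZetaTerm a b n = (((-1 : ℝ) ^ n *
      log ‖riemannZeta ((b + π / (2 * a) + π / a * n : ℝ) : ℂ)‖ : ℝ) : ℂ) := by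
  have hc := one_lt_strip_center ha hab
  have hn : 0 ≤ π / a * n := by positivity
  unfold logZetaTerm
  rw [show b + π / (2 * a) + π * (n : ℝ) / a = b + π / (2 * a) + π / a * n by ring,
    log_riemannZeta_ofReal (by linarith)]
  push_cast
  ring

theorem theorem1 (a b : ℝ) (hb : 1 / 2 ≤ b) (hb1 : b < 1) (ha : 0 < a)
    (hab : a * (1 - b) < Real.pi / 2) :
    IntegrableOn (logZetaCoshIntegrand a b) (Set.Ioi 0) volume ∧
    Summable (logZetaTerm a b) ∧
    (LogZetaCoshIdentity a b ↔ ∀ s : ℂ, s ≠ 1 → b < s.re → riemannZeta s ≠ 0) ∧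
    (b = 1 / 2 → (LogZetaCoshIdentity a b ↔ RiemannHypothesis)) := by
  obtain ⟨hI, hmean⟩ := logLineMean_riemannZeta_eq hb hb1 ha hab
  have hterm : logZetaTerm a b = fun n : ℕ => (((-1 : ℝ) ^ n *
      log ‖riemannZeta ((b + π / (2 * a) + π / a * n : ℝ) : ℂ)‖ : ℝ) : ℂ) :=
    funext (logZetaTerm_eq ha hab)
  have hiff : LogZetaCoshIdentity a b ↔ ∀ s : ℂ, s ≠ 1 → b < s.re → riemannZeta s ≠ 0 := by
    rw [← zetaStripDefect_eq_zero_iff hb hb1 ha hab]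
    unfold LogZetaCoshIdentity
    rw [hterm, ← Complex.ofReal_tsum, ← Complex.ofReal_add, Complex.ofReal_inj,
      integral_logZetaCoshIntegrand ha, hmean]
    simp
  refine ⟨?_, ?_, hiff, ?_⟩
  · have h := (hI.const_mul (2 * π / a)).integrableOn (s := Ioi 0)
    refine h.congr_fun (fun t _ => (logZetaCoshIntegrand_eq ha b t).symm) measurableSet_Ioi
  · rw [hterm]
    exact Complex.summable_ofReal.2
      (summable_log_norm_riemannZeta ha (one_lt_strip_center ha hab))
  · rintro rfl
    rw [hiff, riemannHypothesis_iff]
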